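/- **Setting.** A Bayesian interactive decision-making task has a finite decision space $\Pi$ of size $K$, a finite non-empty context set $\mathcal C$ and a class $\mathcal M$ of models $m$ with mean rewards $\mu_m(\pi,c)\in[0,1]$. A prior $P$ is a Borel probability measure on $\mathcal M\times\mathcal C$. A model $m$ is drawn from $P$ once; then, in each of $T$ rounds, a context $c_t\sim P(\cdot\mid m)$ is drawn and revealed, the agent draws a decision $\pi_t$ from a stochastic decision $p_t$ that is a function of $c_t$ and of the history $\mathcal H_{t-1}$ of past contexts, decisions and observations, a reward $r_t$ in $\{0,1\}$ with mean $\mu_m(\pi_t,c_t)$ is generated, and the agent observes $r_t$. Let $\pi^*_{m,c}$ be the maximizer of $\mu_m(\cdot,c)$ (the first one in case of ties) and $\pi^*_m=(\pi^*_{m,c})_c$. The Bayesian regret of the agent is $\mathbb E\sum_{t\le T}(\mu_m(\pi^*_{m,c_t},c_t)-r_t)$. Logarithms are to base $2$. The agent *accumulates at most $R$ bits* if $I(\pi^*_m;\mathcal H_T)\le R$, or, in the per-round sense, if $\mathbb E\,\mathrm{KL}(p_t\,\|\,P^{\pi^*_{\cdot,c_t}})\le R$ for all $t\le T$, where $P^{\pi^*_{\cdot,c}}$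 is the prior law of $\pi^*_{m,c}$. For either sense, let $\mathcal{BR}^*_R(T)$ be the supremum, over all priors for which some agent accumulates at most $R$ bits, of the infimum of the Bayesian regret over all such agents. **Proposition.** There is an absolute constant $a>0$ such that the following holds for either sense of accumulated information, every finite non-empty context set $\mathcal C$ and every $T\ge 0$. 1. Let $K\ge2$ and let $\mathcal M$ be the set of all functions $\mu:\Pi\times\mathcal C\to[0,1]$ (the $K$-armed Bernoulli bandit). If $0<R\le\log K$, then $$\mathcal{BR}^*_R(T)\ \ge\ a\,\min\Big\{T,\ \sqrt{TK\,\tfrac{\log K}{R}}\Big\},$$ so that $\mathcal{BR}^*_R(T)\ge a\sqrt{TK\log K/R}$ for $T\ge K\log K/R$. If $R=0$, the worst-case regret is linear: $aT\le\mathcal{BR}^*_0(T)\le T$. 2. Let $K\ge d\ge2$ and $0<R\le\log K$. There is a set $\Pi$ of $K$ vectors in the Euclidean unit ball $\mathbb B_2^d$, spanning $\mathbb R^d$ and independent of $T$ and $\mathcal C$, such that for the class $\mathcal M$ of all mean rewards $\mu(\pi,c)=\langle\theta_c,\pi\rangle$ that are linear in the decision and take values in $[0,1]$ on $\Pi\times\mathcal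 C$, $$\mathcal{BR}^*_R(T)\ \ge\ a\,\min\Big\{T\,K^{-8/d},\ \sqrt{Td\,\tfrac{\log K}{R}}\Big\},$$ so that $\mathcal{BR}^*_R(T)\ge a\sqrt{Td\log K/R}$ for $T\ge K^{16/d}\,d\log K/R$ (where $K^{16/d}\le 2^{16}$ if $K\le2^d$). For $R=0$ there is such a $\Pi$ for which $aT\le\mathcal{BR}^*_0(T)\le T$. -/

import Mathlib

open MeasureTheory ProbabilityTheory
open scoped ENNReal

noncomputable section

/-- A Bayesian interactive decision-making task, without its prior: a model `m` together with a
context `c` and a decision `d` determines the joint law of the observation shown to the agent and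
of the reward, which lies in `[0,1]`. Its second marginal is the reward distribution
`R_m(d, c)`. -/
structure DecisionTask (M C D O : Type*) [MeasurableSpace M] [MeasurableSpace C]
    [MeasurableSpace D] [MeasurableSpace O] where
  feedback : Kernel (M × (C × D)) (O × ℝ)
  isMarkov : IsMarkovKernel feedback
  reward_mem : ∀ x, ∀ᵐ y ∂(feedback x), y.2 ∈ Set.Icc (0 : ℝ) 1

attribute [instance] DecisionTask.isMarkov

/-- Sequences of `t` rounds with values in `S`. -/
def History.{u} (S : Type u) : ℕ → Type u
  | 0 => PUnit.{u + 1}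
  | t + 1 => History S t × S

instance History.measurableSpace (S : Type*) [MeasurableSpace S] :
    ∀ t, MeasurableSpace (History S t)
  | 0 => (⊤ : MeasurableSpace PUnit)
  | t + 1 =>
    @Prod.instMeasurableSpace (History S t) S (History.measurableSpace S t) inferInstance

/-- What the agent records in one round: context, decision, observation. -/
abbrev Round (C D O : Type*) := (C × D) × O

/-- An agent: in the round that follows `t` completed rounds, the stochastic decision is a
function of the history of these rounds and of the context just revealed. -/
structure Agent (C D O : Type*) [MeasurableSpace C] [MeasurableSpace D] [MeasurableSpace O] where
  policy : ∀ t, Kernel (History (Round C D O) t × C) D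
  isMarkov : ∀ t, IsMarkovKernel (policy t)

attribute [instance] Agent.isMarkov

/-- The mutual information `I(X;Y)`, in bits, of a pair `(X,Y)` with the given joint law. -/
def mutualInfoBits {X Y : Type*} [MeasurableSpace X] [MeasurableSpace Y]
    (joint : Measure (X × Y)) : ℝ≥0∞ :=
  InformationTheory.klDiv joint (joint.fst.prod joint.snd) / ENNReal.ofReal (Real.log 2)

/-- The Kullback-Leibler divergence in bits. -/
def klBits {X : Type*} [MeasurableSpace X] (μ ν : Measure X) : ℝ≥0∞ :=
  InformationTheory.klDiv μ ν / ENNReal.ofReal (Real.log 2)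

/-- The two ways to count the information that an agent accumulates about the optimal decision:
`total` is the mutual information between the optimal decision and the whole history; `perRound`
is, at each round, the divergence of the stochastic decision from the prior law of the optimal
decision. -/
inductive InfoNotion
  | total
  | perRound

namespace DecisionTask

variable {M C D O : Type*} [MeasurableSpace M] [MeasurableSpace C] [MeasurableSpace D]
  [MeasurableSpace O]

/-- The mean reward `μ_m(d, c)`. -/
def mean (task : DecisionTask M C D O) (m : M) (d : D) (c : C) : ℝ :=
  ∫ y, y.2 ∂(task.feedback (m, (c, d)))

section Optimal

variable [Fintype D] [Nonempty D]

theorem exists_best (task : DecisionTask M C D O) (m : M) (c : C) :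
    (Finset.univ.filter fun d : D => ∀ d', task.mean m d' c ≤ task.mean m d c).Nonempty := by
  obtain ⟨d, hd⟩ := Finite.exists_max fun d : D => task.mean m d c
  exact ⟨d, by simpa using hd⟩

variable [LinearOrder D]

/-- The optimal decision of model `m` in context `c` (the first one, if there are several). -/
def best (task : DecisionTask M C D O) (m : M) (c : C) : D :=
  (Finset.univ.filter fun d : D => ∀ d', task.mean m d' c ≤ task.mean m d c).min'
    (task.exists_best m c)

end Optimal

section Game

variable [StandardBorelSpace C] [Nonempty C]

/-- The law of the context of a round, given the model (and, vacuously, the past rounds). -/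
def contextKernel (P : ProbabilityMeasure (M × C)) (H : Type*) [MeasurableSpace H] :
    Kernel (M × H) C :=
  (P : Measure (M × C)).condKernel.comap Prod.fst measurable_fst

/-- Context and decision of the round after `t` completed rounds, given model and history. -/
def decisionKernel (P : ProbabilityMeasure (M × C)) (agent : Agent C D O) (t : ℕ) :
    Kernel (M × History (Round C D O) t) (C × D) :=
  contextKernel P (History (Round C D O) t) ⊗ₖ
    (agent.policy t).comap
      (fun x : (M × History (Round C D O) t) × C => (x.1.2, x.2)) (by fun_prop)

/-- Context, decision, observation and reward of the round after `t` completed rounds, given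
model and history. -/
def roundKernel (task : DecisionTask M C D O) (P : ProbabilityMeasure (M × C))
    (agent : Agent C D O) (t : ℕ) :
    Kernel (M × History (Round C D O) t) ((C × D) × (O × ℝ)) :=
  decisionKernel P agent t ⊗ₖ
    task.feedback.comap
      (fun x : (M × History (Round C D O) t) × (C × D) => (x.1.1, x.2)) (by fun_prop)

/-- The joint law of the model and of the history `H_t` of the first `t` rounds. -/
def gameLaw (task : DecisionTask M C D O) (P : ProbabilityMeasure (M × C))
    (agent : Agent C D O) : ∀ t, Measure (M × History (Round C D O) t)
  | 0 => (P : Measure (M × C)).fst.map fun m => (m, PUnit.unit)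
  | t + 1 =>
    (task.gameLaw P agent t ⊗ₘ task.roundKernel P agent t).map
      fun x => (x.1.1, (x.1.2, (x.2.1, x.2.2.1)))

variable [Fintype D] [Nonempty D] [LinearOrder D]

/-- The Bayesian regret of `T` rounds: the sum over the rounds of the expectation of
`μ_m(π*, c) - r`. -/
def bayesRegret (task : DecisionTask M C D O) (P : ProbabilityMeasure (M × C))
    (agent : Agent C D O) (T : ℕ) : ℝ :=
  ∑ t ∈ Finset.range T,
    ∫ x, (task.mean x.1.1 (task.best x.1.1 x.2.1.1) x.2.1.1 - x.2.2.2)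
      ∂(task.gameLaw P agent t ⊗ₘ task.roundKernel P agent t)

/-- `I(π*; H_T)` in bits, where `π*` is the optimal decision as a function of the context. -/
def totalInfo (task : DecisionTask M C D O) (P : ProbabilityMeasure (M × C))
    (agent : Agent C D O) (T : ℕ) : ℝ≥0∞ :=
  mutualInfoBits ((task.gameLaw P agent T).map fun x => (task.best x.1, x.2))

/-- `KL(p ‖ P^{π*})` in bits, in expectation over history and context, for the stochastic
decision `p` that the agent takes after `t` completed rounds; `P^{π*}` is the prior law of the
optimal decision in the revealed context. -/
def roundInfo (task : DecisionTask M C D O) (P : ProbabilityMeasure (M × C))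
    (agent : Agent C D O) (t : ℕ) : ℝ≥0∞ :=
  ∫⁻ x, klBits (agent.policy t (x.1.2, x.2))
      ((P : Measure (M × C)).fst.map fun m => task.best m x.2)
    ∂(task.gameLaw P agent t ⊗ₘ contextKernel P (History (Round C D O) t))

/-- The agent accumulates at most `R` bits in a game of `T` rounds. -/
def AccumulatesAtMost (task : DecisionTask M C D O) (notion : InfoNotion)
    (P : ProbabilityMeasure (M × C)) (R : ℝ) (T : ℕ) (agent : Agent C D O) : Prop :=
  match notion with
  | InfoNotion.total => task.totalInfo P agent T ≤ ENNReal.ofReal R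
  | InfoNotion.perRound => ∀ t < T, task.roundInfo P agent t ≤ ENNReal.ofReal R

/-- The worst-case Bayesian regret of agents that accumulate at most `R` bits: the supremum over
the priors of the infimum over these agents. Priors for which there is no such agent are left
out, so that the supremum is never reached through an infimum over the empty set. -/
def worstCaseRegret (task : DecisionTask M C D O) (notion : InfoNotion) (R : ℝ) (T : ℕ) :
    EReal :=
  ⨆ (P : ProbabilityMeasure (M × C))
    (_ : ∃ agent : Agent C D O, task.AccumulatesAtMost notion P R T agent),
    ⨅ (agent : Agent C D O) (_ : task.AccumulatesAtMost notion P R T agent),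
      (task.bayesRegret P agent T : EReal)

end Game

end DecisionTask

section Bernoulli

variable {M C D : Type*} [MeasurableSpace M] [MeasurableSpace C] [MeasurableSpace D]

/-- The law of (observation, reward) for a Bernoulli reward with mean `p`, when the observation
is the reward itself (as a truth value). -/
def bernoulliFeedback (p : ℝ) : Measure (Bool × ℝ) :=
  ENNReal.ofReal p • Measure.dirac (true, 1) + ENNReal.ofReal (1 - p) • Measure.dirac (false, 0)

theorem measurable_bernoulliFeedback : Measurable bernoulliFeedback := by
  refine Measure.measurable_of_measurable_coe _ fun s hs => ?_
  simp only [bernoulliFeedback, Measure.add_apply, Measure.smul_apply, smul_eq_mul]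
  exact (measurable_id.ennreal_ofReal.mul_const _).add
    ((measurable_const.sub measurable_id).ennreal_ofReal.mul_const _)

theorem isProbabilityMeasure_bernoulliFeedback {p : ℝ} (h : p ∈ Set.Icc (0 : ℝ) 1) :
    IsProbabilityMeasure (bernoulliFeedback p) := by
  refine ⟨?_⟩
  simp only [bernoulliFeedback, Measure.add_apply, Measure.smul_apply, smul_eq_mul,
    measure_univ, mul_one]
  rw [← ENNReal.ofReal_add h.1 (by linarith [h.2])]
  simp

theorem reward_mem_bernoulliFeedback (p : ℝ) :
    ∀ᵐ y ∂(bernoulliFeedback p), y.2 ∈ Set.Icc (0 : ℝ) 1 := by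
  have hs : MeasurableSet {y : Bool × ℝ | y.2 ∈ Set.Icc (0 : ℝ) 1} :=
    measurable_snd measurableSet_Icc
  rw [bernoulliFeedback, ae_add_measure_iff]
  exact ⟨Measure.ae_smul_measure ((ae_dirac_iff hs).2 (by norm_num)) _,
    Measure.ae_smul_measure ((ae_dirac_iff hs).2 (by norm_num)) _⟩

/-- The task with Bernoulli rewards of mean `f m d c`, where the agent observes the reward. -/
def bernoulliTask (f : M → D → C → ℝ) (hf : Measurable fun x : M × (C × D) => f x.1 x.2.2 x.2.1)
    (h01 : ∀ m d c, f m d c ∈ Set.Icc (0 : ℝ) 1) : DecisionTask M C D Bool where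
  feedback :=
    { toFun := fun x => bernoulliFeedback (f x.1 x.2.2 x.2.1)
      measurable' := measurable_bernoulliFeedback.comp hf }
  isMarkov := ⟨fun x => isProbabilityMeasure_bernoulliFeedback (h01 x.1 x.2.2 x.2.1)⟩
  reward_mem := fun x => reward_mem_bernoulliFeedback (f x.1 x.2.2 x.2.1)

end Bernoulli

/-- The contextual `K`-armed bandit with Bernoulli rewards: the models are all functions
`{1, …, K} × C → [0,1]`. -/
def bernoulliMAB (K : ℕ) (C : Type*) [Fintype C] [MeasurableSpace C]
    [MeasurableSingletonClass C] :
    DecisionTask (Fin K → C → Set.Icc (0 : ℝ) 1) C (Fin K) Bool :=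
  bernoulliTask (fun m d c => (m d c : ℝ))
    (measurable_from_prod_countable_left fun x =>
      measurable_subtype_coe.comp
        ((measurable_pi_apply x.1).comp (measurable_pi_apply x.2)))
    (fun m d c => (m d c).2)

/-- The models of a linear bandit with decisions `x 1, …, x K` in `ℝ^d`: all families of
vectors `θ`, one for each context, for which every mean reward `⟪θ c, x k⟫` lies in `[0,1]`. -/
abbrev LinearModel {d K : ℕ} (x : Fin K → EuclideanSpace ℝ (Fin d)) (C : Type*) :=
  {θ : C → EuclideanSpace ℝ (Fin d) // ∀ k c, inner ℝ (θ c) (x k) ∈ Set.Icc (0 : ℝ) 1}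

/-- The contextual bandit with decisions `x 1, …, x K` in `ℝ^d` and Bernoulli rewards whose mean
is a linear function of the decision. -/
def linearBandit {d K : ℕ} (x : Fin K → EuclideanSpace ℝ (Fin d)) (C : Type*) [Fintype C]
    [MeasurableSpace C] [MeasurableSingletonClass C] :
    DecisionTask (LinearModel x C) C (Fin K) Bool :=
  bernoulliTask (fun θ k c => inner ℝ (θ.1 c) (x k))
    (measurable_from_prod_countable_left fun y => by
      have h : Measurable fun θ : LinearModel x C => θ.1 y.1 :=
        (measurable_pi_apply y.1).comp measurable_subtype_coe
      exact h.inner (measurable_const (a := x y.2)))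
    (fun θ k c => θ.2 k c)

end

/-!
For each `R` it is enough to exhibit one prior. All priors below are uniform on a finite family of
models, all of which have the same means in every context, with one fixed context. Each family
contains a decision whose mean reward is the same in all models. Therefore an agent without any
information on the optimal decision exists in either sense (`exists_accumulatesAtMost`): one that
always takes this decision, or one that samples from the prior law of the optimal decision.

The lower bounds on the regret of all agents come in two kinds, according to the size of `R`.

* If `R ≤ log K / 32`, the agent has too little information to guess the optimal decision, and the
  regret is linear in `T`, however easy the models are to tell apart. In either sense of
  accumulated information this is one application of the Donsker-Varadhan inequality
  `ofReal_integral_add_le_klDiv`, with a multiple of the loss of the decision in round `t` as the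
  test function: for `totalInfo` to the joint law of optimal decision and history, for `roundInfo`
  to the stochastic decision. This gives `le_worstCaseRegret_of_low_information`, which asks only
  that a decision made without knowledge of the model is bad in the sense of exponential moments.
* If `R > log K / 32`, the factor `log K / R` is bounded, and the claim is the classical lower
  bound of order `√(T N)` for `N` arms, one of which is better than the others by
  `Δ ≈ √(N / T)`. It holds for all agents (`le_worstCaseRegret_of_smallGaps`). The proof changes
  the measure to one fixed model, under which the expected log-likelihood ratios of all `N` models
  add up to at most the order of `Δ² T` in absolute value.

For the multi-armed bandit, both bounds are applied to the same family, `needleMean`. For linear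
rewards, this family is realized with an orthonormal basis as the good arms
(`exists_orthonormal_decisions`). The basis suffices for `R > log K / 32`, for `R = 0` and for
`K ≤ 2 d + 1`. In the remaining case, `N ≥ K ^ (1 / 4)` of the decisions are unit vectors on a grid
`{1, …, s} ^ n` of points of a product of `n ≤ d / 2` circles, and the models are the same vectors
(`exists_grid_decisions`). Two grid points in which a constant fraction of the coordinates differ
have an inner product of at most `1 - c / s ^ 2`, where `s ^ 2` is of the order of at most
`K ^ (8 / d)`, and a grid point chosen blindly differs from the right one in that many coordinates
often enough (`inv_mul_sum_exp_hammingDist_le`).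
-/

/-! ### The Donsker-Varadhan inequality -/

/-- The Donsker-Varadhan inequality: `F` enters the integral under `μ` of the log-likelihood
ratio of `μ` against the tilted measure `ν.tilted F`, for which Gibbs' inequality holds. -/
theorem ofReal_integral_add_le_klDiv {X : Type*} [MeasurableSpace X] (μ ν : Measure X)
    [IsProbabilityMeasure μ] [IsProbabilityMeasure ν] {F : X → ℝ}
    (hFμ : Integrable F μ) (hFν : Integrable (fun x => Real.exp (F x)) ν) {κ : ℝ}
    (hκ : ∫ x, Real.exp (F x) ∂ν ≤ Real.exp (-κ)) :
    ENNReal.ofReal (∫ x, F x ∂μ + κ) ≤ InformationTheory.klDiv μ ν := by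
  by_cases htop : InformationTheory.klDiv μ ν = ∞
  · simp [htop]
  refine ENNReal.ofReal_le_of_le_toReal ?_
  obtain ⟨hac, hint⟩ := InformationTheory.klDiv_ne_top_iff.1 htop
  rw [InformationTheory.toReal_klDiv_of_measure_eq hac (by simp)]
  have h2 := integral_llr_tilted_right hac hFμ hFν hint
  have hac' : μ ≪ ν.tilted F := hac.trans (absolutelyContinuous_tilted hFν)
  have : IsProbabilityMeasure (ν.tilted F) := isProbabilityMeasure_tilted hFν
  have h3 := InformationTheory.integral_llr_add_sub_measure_univ_nonneg hac'
    (integrable_llr_tilted_right hac hFμ hint hFν)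
  simp only [probReal_univ] at h3
  have h4 := (Real.log_le_iff_le_exp (integral_exp_pos hFν)).2 hκ
  linarith

/-! ### Finitely supported measures -/

/-- The measure with mass `a j` at the point `x j`, for `j` in a finite type; negative weights
count as zero. -/
noncomputable def atomic {J X : Type*} [Fintype J] [MeasurableSpace X] (a : J → ℝ) (x : J → X) :
    Measure X :=
  ∑ j, ENNReal.ofReal (a j) • Measure.dirac (x j)

section Atomic

variable {J J' X Y : Type*} [Fintype J] [Fintype J'] [MeasurableSpace X] [MeasurableSpace Y]

theorem lintegral_atomic [MeasurableSingletonClass X] (a : J → ℝ) (x : J → X) (g : X → ℝ≥0∞) :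
    ∫⁻ y, g y ∂(atomic a x) = ∑ j, ENNReal.ofReal (a j) * g (x j) := by
  simp [atomic, lintegral_smul_measure, lintegral_dirac]

theorem lintegral_atomic_of_measurable (a : J → ℝ) (x : J → X) {g : X → ℝ≥0∞}
    (hg : Measurable g) :
    ∫⁻ y, g y ∂(atomic a x) = ∑ j, ENNReal.ofReal (a j) * g (x j) := by
  simp [atomic, lintegral_smul_measure, lintegral_dirac' _ hg]

theorem atomic_apply (a : J → ℝ) (x : J → X) {s : Set X} (hs : MeasurableSet s) :
    atomic a x s = ∑ j, ENNReal.ofReal (a j) * s.indicator 1 (x j) := by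
  rw [← lintegral_indicator_one hs,
    lintegral_atomic_of_measurable a x (measurable_one.indicator hs)]

theorem isProbabilityMeasure_atomic {a : J → ℝ} (x : J → X) (ha : ∀ j, 0 ≤ a j)
    (h1 : ∑ j, a j = 1) : IsProbabilityMeasure (atomic a x) := by
  refine ⟨?_⟩
  rw [atomic_apply a x MeasurableSet.univ]
  simp [← ENNReal.ofReal_sum_of_nonneg fun j _ => ha j, h1]

instance isFiniteMeasure_atomic (a : J → ℝ) (x : J → X) : IsFiniteMeasure (atomic a x) := by
  refine ⟨?_⟩
  rw [atomic_apply a x MeasurableSet.univ]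
  simp [ENNReal.sum_lt_top]

theorem integrable_atomic [MeasurableSingletonClass X] (a : J → ℝ) (x : J → X) (g : X → ℝ) :
    Integrable g (atomic a x) := by
  refine integrable_finsetSum_measure.2 fun j _ => ?_
  exact (integrable_dirac (by simp)).smul_measure ENNReal.ofReal_ne_top

theorem integral_atomic [MeasurableSingletonClass X] {a : J → ℝ} (ha : ∀ j, 0 ≤ a j)
    (x : J → X) (g : X → ℝ) : ∫ y, g y ∂(atomic a x) = ∑ j, a j * g (x j) := by
  rw [atomic, integral_finsetSum_measure]
  · refine Finset.sum_congr rfl fun j _ => ?_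
    rw [integral_smul_measure, integral_dirac, ENNReal.toReal_ofReal (ha j), smul_eq_mul]
  · exact fun j _ => (integrable_dirac (by simp)).smul_measure ENNReal.ofReal_ne_top

theorem aemeasurable_atomic [MeasurableSingletonClass X] (a : J → ℝ) (x : J → X) (g : X → Y) :
    AEMeasurable g (atomic a x) := by
  rw [atomic, ← Measure.sum_fintype]
  refine AEMeasurable.sum_measure fun j => ?_
  exact aemeasurable_dirac.smul_measure _

/-- No measurability of `g` is needed, as every function is almost everywhere measurable with
respect to a finitely supported measure. -/
theorem map_atomic [MeasurableSingletonClass X] (a : J → ℝ) (x : J → X) (g : X → Y) :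
    (atomic a x).map g = atomic a (g ∘ x) := by
  ext s hs
  rw [Measure.map_apply_of_aemeasurable (aemeasurable_atomic a x g) hs, atomic_apply _ _ hs]
  simp [atomic, Measure.dirac_apply, Set.indicator, Measure.finsetSum_apply]
  rfl

theorem map_atomic_of_measurable (a : J → ℝ) (x : J → X) {g : X → Y} (hg : Measurable g) :
    (atomic a x).map g = atomic a (g ∘ x) := by
  ext s hs
  rw [Measure.map_apply hg hs, atomic_apply _ _ hs, atomic_apply _ _ (hg hs)]
  simp [Set.indicator]
  rfl

theorem atomic_equiv (e : J' ≃ J) (a : J → ℝ) (x : J → X) :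
    atomic (a ∘ e) (x ∘ e) = atomic a x :=
  e.sum_comp fun j => ENNReal.ofReal (a j) • Measure.dirac (x j)

theorem atomic_compProd {a : J → ℝ} (ha : ∀ j, 0 ≤ a j) (x : J → X) (κ : Kernel X Y)
    [IsSFiniteKernel κ] (b : J → J' → ℝ) (y : J → J' → Y)
    (hκ : ∀ j, κ (x j) = atomic (b j) (y j)) :
    atomic a x ⊗ₘ κ =
      atomic (fun k : J × J' => a k.1 * b k.1 k.2) fun k => (x k.1, y k.1 k.2) := by
  ext s hs
  rw [Measure.compProd_apply hs, lintegral_atomic_of_measurable _ _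
    (Kernel.measurable_kernel_prodMk_left hs), atomic_apply _ _ hs, Fintype.sum_prod_type]
  refine Finset.sum_congr rfl fun j _ => ?_
  rw [hκ, atomic_apply _ _ (measurable_prodMk_left hs), Finset.mul_sum]
  refine Finset.sum_congr rfl fun k _ => ?_
  rw [ENNReal.ofReal_mul (ha j), mul_assoc]
  rfl

theorem atomic_prod {a : J → ℝ} (ha : ∀ j, 0 ≤ a j) (x : J → X) (b : J' → ℝ) (y : J' → Y) :
    (atomic a x).prod (atomic b y) =
      atomic (fun k : J × J' => a k.1 * b k.2) fun k => (x k.1, y k.2) := by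
  rw [← Measure.compProd_const]
  exact atomic_compProd ha x _ (fun _ => b) (fun _ => y) fun _ => rfl

/-- A finite measure on a finite discrete space is the sum of its atoms. -/
theorem eq_atomic_real [Fintype X] [MeasurableSingletonClass X] (μ : Measure X)
    [IsFiniteMeasure μ] : μ = atomic (fun x => μ.real {x}) id := by
  refine Measure.ext_of_singleton fun x => ?_
  rw [atomic_apply _ _ (measurableSet_singleton x), Finset.sum_eq_single x]
  · simp
  · intro y _ hy
    simp [hy]
  · simp

theorem ae_atomic [MeasurableSingletonClass X] {a : J → ℝ} (x : J → X) {p : X → Prop}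
    (h : ∀ᵐ y ∂(atomic a x), p y) {j : J} (hj : 0 < a j) : p (x j) := by
  have h0 : atomic a x {y | ¬ p y} = 0 := ae_iff.1 h
  by_contra hp
  have h1 : atomic a x {x j} = 0 := measure_mono_null (by simpa using hp) h0
  rw [atomic_apply _ _ (measurableSet_singleton _), Finset.sum_eq_zero_iff] at h1
  have := h1 j (Finset.mem_univ j)
  simp [hj.not_ge] at this

end Atomic

/-! ### Trajectories of a game with Bernoulli rewards -/

instance History.fintype (S : Type*) [Fintype S] : ∀ t, Fintype (History S t)
  | 0 => inferInstanceAs (Fintype PUnit)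
  | t + 1 =>
    letI := History.fintype S t
    inferInstanceAs (Fintype (History S t × S))

instance History.measurableSingletonClass (S : Type*) [MeasurableSpace S]
    [MeasurableSingletonClass S] : ∀ t, MeasurableSingletonClass (History S t)
  | 0 => inferInstanceAs (MeasurableSingletonClass PUnit)
  | t + 1 =>
    haveI := History.measurableSingletonClass S t
    inferInstanceAs (MeasurableSingletonClass (History S t × S))

/-- The decisions and observations of `t` rounds. Contexts are left out, as the priors in use
have only one context. -/
abbrev Trajectory (D : Type*) (t : ℕ) := History (D × Bool) t

theorem Trajectory.sum_succ {D : Type*} [Fintype D] {t : ℕ} (g : Trajectory D (t + 1) → ℝ) :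
    ∑ h, g h = ∑ h : Trajectory D t, ∑ d : D, ∑ o : Bool, g (h, (d, o)) := by
  refine (Fintype.sum_prod_type (α₁ := Trajectory D t) (α₂ := D × Bool) fun h => g h).trans ?_
  exact Finset.sum_congr rfl fun h _ => Fintype.sum_prod_type fun x => g (h, x)

/-- The trajectory as a history in which every context is `c`. -/
def Trajectory.toHistory {C D : Type*} (c : C) :
    ∀ {t : ℕ}, Trajectory D t → History (Round C D Bool) t
  | 0, _ => PUnit.unit
  | _ + 1, h => (Trajectory.toHistory c h.1, ((c, h.2.1), h.2.2))

/-- The probability of the observation `o` of a Bernoulli reward with mean `p`. -/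
noncomputable def likelihood (p : ℝ) (o : Bool) : ℝ := if o then p else 1 - p

theorem sum_likelihood (p : ℝ) : ∑ o, likelihood p o = 1 := by simp [likelihood]

theorem likelihood_nonneg {p : ℝ} (hp : p ∈ Set.Icc (0 : ℝ) 1) (o : Bool) :
    0 ≤ likelihood p o := by
  cases o <;> simp [likelihood, hp.1, hp.2]

section TrajectoryWeight

variable {D : Type*}

/-- The probability of a trajectory when the arms have the means `μ` and the decision `d` is taken
with probability `q t h d` after the trajectory `h` of `t` rounds. -/
noncomputable def trajectoryWeight (q : ∀ t, Trajectory D t → D → ℝ) (μ : D → ℝ) :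
    ∀ t, Trajectory D t → ℝ
  | 0, _ => 1
  | t + 1, h => trajectoryWeight q μ t h.1 * (q t h.1 h.2.1 * likelihood (μ h.2.1) h.2.2)

variable {q : ∀ t, Trajectory D t → D → ℝ} {μ : D → ℝ}

theorem trajectoryWeight_nonneg (hq : ∀ t h d, 0 ≤ q t h d) (hμ : ∀ d, μ d ∈ Set.Icc (0 : ℝ) 1) :
    ∀ t h, 0 ≤ trajectoryWeight q μ t h
  | 0, _ => zero_le_one
  | t + 1, h => mul_nonneg (trajectoryWeight_nonneg hq hμ t h.1)
      (mul_nonneg (hq t h.1 h.2.1) (likelihood_nonneg (hμ _) _))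

variable [Fintype D]

theorem sum_trajectoryWeight_succ_mul (t : ℕ) (g : Trajectory D t → D → ℝ) :
    ∑ h : Trajectory D (t + 1), trajectoryWeight q μ (t + 1) h * g h.1 h.2.1 =
      ∑ h, trajectoryWeight q μ t h * ∑ d, q t h d * g h d := by
  rw [Trajectory.sum_succ]
  refine Finset.sum_congr rfl fun h _ => ?_
  rw [Finset.mul_sum]
  refine Finset.sum_congr rfl fun d _ => ?_
  calc ∑ o, trajectoryWeight q μ t h * (q t h d * likelihood (μ d) o) * g h d
      = trajectoryWeight q μ t h * (q t h d * g h d) * ∑ o, likelihood (μ d) o := by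
        rw [Finset.mul_sum]
        exact Finset.sum_congr rfl fun o _ => by ring
    _ = trajectoryWeight q μ t h * (q t h d * g h d) := by rw [sum_likelihood, mul_one]

theorem sum_trajectoryWeight (hq1 : ∀ t h, ∑ d, q t h d = 1) :
    ∀ t, ∑ h, trajectoryWeight q μ t h = 1
  | 0 => by
    change ∑ _h : PUnit, (1 : ℝ) = 1
    simp
  | t + 1 => by
    have := sum_trajectoryWeight_succ_mul (q := q) (μ := μ) t fun _ _ => 1
    simpa [hq1, sum_trajectoryWeight hq1 t] using this

end TrajectoryWeight

/-- The decision of round `t` (counted from zero), read off from the history of `T > t`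
rounds. -/
def decisionAt {C D : Type*} [Inhabited D] (t : ℕ) : ∀ T, History (Round C D Bool) T → D
  | 0, _ => default
  | T + 1, h => if T = t then h.2.1.2 else decisionAt t T h.1

theorem sum_trajectoryWeight_mul_decisionAt {C D : Type*} [Fintype D] [Inhabited D] (c : C)
    {q : ∀ t, Trajectory D t → D → ℝ} {μ : D → ℝ} (hq1 : ∀ t h, ∑ d, q t h d = 1) (g : D → ℝ)
    {t T : ℕ} (hT : t < T) :
    ∑ h, trajectoryWeight q μ T h * g (decisionAt t T (h.toHistory c)) =
      ∑ h, trajectoryWeight q μ t h * ∑ d, q t h d * g d := by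
  induction T with
  | zero => omega
  | succ T ih =>
    rcases eq_or_ne T t with rfl | hne
    · rw [← sum_trajectoryWeight_succ_mul]
      refine Finset.sum_congr rfl fun h _ => ?_
      simp [decisionAt, Trajectory.toHistory]
    · rw [← ih (by omega)]
      have := sum_trajectoryWeight_succ_mul (q := q) (μ := μ) T
        fun h _ => g (decisionAt t T (h.toHistory c))
      simp only [← Finset.sum_mul, hq1, one_mul] at this
      rw [← this]
      refine Finset.sum_congr rfl fun h _ => ?_
      simp [decisionAt, Trajectory.toHistory, hne]

/-! ### The law of the game under a finitely supported prior -/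

namespace DecisionTask

variable {M C D O : Type*} [MeasurableSpace M] [MeasurableSpace C] [MeasurableSpace D]
  [MeasurableSpace O] [StandardBorelSpace C] [Nonempty C]

instance isMarkovKernel_contextKernel (P : ProbabilityMeasure (M × C)) (H : Type*)
    [MeasurableSpace H] : IsMarkovKernel (contextKernel P H) := by
  unfold contextKernel
  infer_instance

instance isMarkovKernel_decisionKernel (P : ProbabilityMeasure (M × C)) (agent : Agent C D O)
    (t : ℕ) : IsMarkovKernel (decisionKernel P agent t) := by
  unfold decisionKernel
  infer_instance

instance isMarkovKernel_roundKernel (task : DecisionTask M C D O)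
    (P : ProbabilityMeasure (M × C)) (agent : Agent C D O) (t : ℕ) :
    IsMarkovKernel (task.roundKernel P agent t) := by
  unfold roundKernel
  infer_instance

instance isProbabilityMeasure_gameLaw (task : DecisionTask M C D O)
    (P : ProbabilityMeasure (M × C)) (agent : Agent C D O) :
    ∀ t, IsProbabilityMeasure (task.gameLaw P agent t)
  | 0 => Measure.isProbabilityMeasure_map (by fun_prop)
  | t + 1 => by
    have := isProbabilityMeasure_gameLaw task P agent t
    exact Measure.isProbabilityMeasure_map (by fun_prop)

end DecisionTask

theorem DecisionTask.mean_bernoulliTask {M C D : Type*} [MeasurableSpace M] [MeasurableSpace C]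
    [MeasurableSpace D] (f : M → D → C → ℝ)
    (hf : Measurable fun x : M × (C × D) => f x.1 x.2.2 x.2.1)
    (h01 : ∀ m d c, f m d c ∈ Set.Icc (0 : ℝ) 1) (m : M) (d : D) (c : C) :
    (bernoulliTask f hf h01).mean m d c = f m d c := by
  change ∫ y, y.2 ∂(bernoulliFeedback (f m d c)) = _
  rw [bernoulliFeedback, integral_add_measure, integral_smul_measure, integral_smul_measure,
    integral_dirac, integral_dirac, ENNReal.toReal_ofReal (h01 m d c).1]
  · simp
  all_goals exact (integrable_dirac (by simp)).smul_measure ENNReal.ofReal_ne_top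

theorem bernoulliFeedback_eq_atomic (p : ℝ) :
    bernoulliFeedback p = atomic (likelihood p) fun o => (o, if o then 1 else 0) := by
  simp [bernoulliFeedback, atomic, likelihood]

section Prob

variable {C D : Type*} [MeasurableSpace C] [MeasurableSpace D]

/-- The probability with which an agent takes the decision `d` after a trajectory, if every context
is `c`. -/
noncomputable def Agent.prob (agent : Agent C D Bool) (c : C) (t : ℕ) (h : Trajectory D t)
    (d : D) : ℝ :=
  (agent.policy t (h.toHistory c, c)).real {d}

theorem Agent.prob_nonneg (agent : Agent C D Bool) (c : C) (t : ℕ) (h : Trajectory D t) (d : D) :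
    0 ≤ agent.prob c t h d := measureReal_nonneg

theorem Agent.sum_prob [Fintype D] [MeasurableSingletonClass D] (agent : Agent C D Bool) (c : C)
    (t : ℕ) (h : Trajectory D t) : ∑ d, agent.prob c t h d = 1 := by
  simp [Agent.prob]

end Prob

section FinitePrior

variable {M C ι : Type*} [MeasurableSpace M] [MeasurableSpace C] [Fintype ι] [Nonempty ι]

/-- The prior under which the model is drawn uniformly from the models `mod i` and the context
is always `c`. -/
noncomputable def uniformPrior (mod : ι → M) (c : C) : ProbabilityMeasure (M × C) :=
  ⟨atomic (fun _ => (Fintype.card ι : ℝ)⁻¹) fun i => (mod i, c),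
    isProbabilityMeasure_atomic _ (fun _ => by positivity) (by simp)⟩

theorem uniformPrior_fst (mod : ι → M) (c : C) :
    (uniformPrior mod c : Measure (M × C)).fst =
      atomic (fun _ => (Fintype.card ι : ℝ)⁻¹) mod :=
  map_atomic_of_measurable _ _ measurable_fst

variable [MeasurableSingletonClass M] [StandardBorelSpace C] [Nonempty C]

/-- Conditional laws are unique only almost everywhere, but each `mod i` is an atom of the prior. -/
theorem contextKernel_uniformPrior (mod : ι → M) (c : C) (H : Type*) [MeasurableSpace H] (i : ι)
    (h : H) : DecisionTask.contextKernel (uniformPrior mod c) H (mod i, h) = Measure.dirac c := by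
  have h1 : (uniformPrior mod c : Measure (M × C)) =
      (uniformPrior mod c : Measure (M × C)).fst ⊗ₘ Kernel.const M (Measure.dirac c) := by
    rw [uniformPrior_fst, atomic_compProd (fun _ => by positivity) _ _ (J' := Unit)
      (fun _ _ => 1) (fun _ _ => c) fun _ => by simp [atomic]]
    have := atomic_equiv (Equiv.prodUnique ι Unit) (fun _ => (Fintype.card ι : ℝ)⁻¹)
      fun i => (mod i, c)
    simp only [mul_one]
    exact this.symm
  have h2 := eq_condKernel_of_measure_eq_compProd _ h1
  rw [uniformPrior_fst] at h2
  exact (ae_atomic mod h2 (by positivity)).symm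

variable {D : Type*} [Fintype D] [MeasurableSpace D]
  [MeasurableSingletonClass D]

variable {f : M → D → C → ℝ} {hf : Measurable fun x : M × (C × D) => f x.1 x.2.2 x.2.1}
  {h01 : ∀ m d c, f m d c ∈ Set.Icc (0 : ℝ) 1} {mod : ι → M} {μ : ι → D → ℝ} {c : C}

theorem roundKernel_eq_atomic (hμ : ∀ i d, f (mod i) d c = μ i d) (agent : Agent C D Bool)
    (t : ℕ) (i : ι) (h : Trajectory D t) :
    (bernoulliTask f hf h01).roundKernel (uniformPrior mod c) agent t (mod i, h.toHistory c) =
      atomic (fun k : D × Bool => agent.prob c t h k.1 * likelihood (μ i k.1) k.2)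
        fun k => ((c, k.1), (k.2, if k.2 then 1 else 0)) := by
  have h1 : DecisionTask.decisionKernel (uniformPrior mod c) agent t (mod i, h.toHistory c) =
      atomic (agent.prob c t h) fun d => (c, d) := by
    rw [DecisionTask.decisionKernel, Kernel.compProd_apply_eq_compProd_sectR,
      contextKernel_uniformPrior]
    have : Measure.dirac c = atomic (fun _ : Unit => (1 : ℝ)) fun _ => c := by simp [atomic]
    rw [this, atomic_compProd (fun _ => zero_le_one) _ _ (fun _ => agent.prob c t h)
      (fun _ d => d)]
    · simpa [Function.comp_def] using
        atomic_equiv (Equiv.uniqueProd D Unit) (agent.prob c t h) fun d => (c, d)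
    · intro _
      simp only [Kernel.sectR_apply, Kernel.comap_apply]
      exact eq_atomic_real _
  rw [DecisionTask.roundKernel, Kernel.compProd_apply_eq_compProd_sectR, h1]
  refine atomic_compProd (agent.prob_nonneg c t h) _ _ (fun d => likelihood (μ i d))
    (fun d o => (o, if o then 1 else 0)) fun d => ?_
  simp only [Kernel.sectR_apply, Kernel.comap_apply]
  change bernoulliFeedback (f (mod i) d c) = _
  rw [hμ, bernoulliFeedback_eq_atomic]

theorem gameLaw_eq_atomic (hμ : ∀ i d, f (mod i) d c = μ i d) (agent : Agent C D Bool) (t : ℕ) :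
    (bernoulliTask f hf h01).gameLaw (uniformPrior mod c) agent t =
      atomic (fun k : ι × Trajectory D t =>
          (Fintype.card ι : ℝ)⁻¹ * trajectoryWeight (agent.prob c) (μ k.1) t k.2)
        fun k => (mod k.1, k.2.toHistory c) := by
  have hμ01 : ∀ i d, μ i d ∈ Set.Icc (0 : ℝ) 1 := fun i d => hμ i d ▸ h01 _ _ _
  induction t with
  | zero =>
    rw [DecisionTask.gameLaw, uniformPrior_fst, map_atomic_of_measurable _ _ (by fun_prop)]
    have := atomic_equiv (Equiv.prodUnique ι PUnit) (fun _ => (Fintype.card ι : ℝ)⁻¹)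
      fun i => (mod i, (PUnit.unit : History (Round C D Bool) 0))
    refine Eq.trans this.symm ?_
    simp only [trajectoryWeight, mul_one]
    rfl
  | succ t ih =>
    have h1 := atomic_compProd (fun k : ι × Trajectory D t => mul_nonneg
        (inv_nonneg.2 (Nat.cast_nonneg (Fintype.card ι)))
        (trajectoryWeight_nonneg (agent.prob_nonneg c) (hμ01 k.1) t k.2)) _
      ((bernoulliTask f hf h01).roundKernel (uniformPrior mod c) agent t) _ _
      fun k => roundKernel_eq_atomic (hf := hf) (h01 := h01) hμ agent t k.1 k.2
    rw [DecisionTask.gameLaw, ih, h1, map_atomic_of_measurable _ _ (by fun_prop)]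
    have := atomic_equiv (Equiv.prodAssoc ι (Trajectory D t) (D × Bool))
      (fun k : ι × Trajectory D (t + 1) =>
          (Fintype.card ι : ℝ)⁻¹ * trajectoryWeight (agent.prob c) (μ k.1) (t + 1) k.2)
      (fun k : ι × Trajectory D (t + 1) => (mod k.1, k.2.toHistory c))
    refine Eq.trans ?_ this
    congr 1
    funext k
    simp only [Function.comp, trajectoryWeight, Equiv.prodAssoc_apply]
    ring

end FinitePrior

/-! ### Optimal decisions, regret and the existence of uninformed agents -/

namespace DecisionTask

theorem mean_le_one {M C D O : Type*} [MeasurableSpace M] [MeasurableSpace C]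
    [MeasurableSpace D] [MeasurableSpace O] (task : DecisionTask M C D O) (m : M) (d : D) (c : C) :
    task.mean m d c ≤ 1 := by
  by_cases hi : Integrable (fun y => y.2) (task.feedback (m, (c, d)))
  · calc task.mean m d c ≤ ∫ _, (1 : ℝ) ∂(task.feedback (m, (c, d))) :=
        integral_mono_ae hi (integrable_const _)
          ((task.reward_mem (m, (c, d))).mono fun y hy => hy.2)
      _ = 1 := by simp
  · rw [mean, integral_undef hi]
    exact zero_le_one

section General

variable {M C D O : Type*} [MeasurableSpace M] [MeasurableSpace C] [MeasurableSpace D]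
  [MeasurableSpace O] [Fintype D] [Nonempty D] [LinearOrder D]

theorem best_eq_of_forall_lt (task : DecisionTask M C D O) {m : M} {c : C} {d₀ : D}
    (h : ∀ d, d ≠ d₀ → task.mean m d c < task.mean m d₀ c) : task.best m c = d₀ := by
  by_contra hne
  have := Finset.min'_mem _ (task.exists_best m c)
  exact ((Finset.mem_filter.1 this).2 d₀).not_gt (h _ hne)

variable [StandardBorelSpace C] [Nonempty C]

theorem le_worstCaseRegret (task : DecisionTask M C D O) {notion : InfoNotion} {R : ℝ} {T : ℕ}
    {r : ℝ} (P : ProbabilityMeasure (M × C))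
    (hP : ∃ agent : Agent C D O, task.AccumulatesAtMost notion P R T agent)
    (h : ∀ agent : Agent C D O, task.AccumulatesAtMost notion P R T agent →
      r ≤ task.bayesRegret P agent T) :
    (r : EReal) ≤ task.worstCaseRegret notion R T :=
  le_iSup₂_of_le P hP (le_iInf₂ fun agent ha => EReal.coe_le_coe_iff.2 (h agent ha))

theorem bayesRegret_le (task : DecisionTask M C D O) (P : ProbabilityMeasure (M × C))
    (agent : Agent C D O) (T : ℕ) : task.bayesRegret P agent T ≤ T := by
  refine (Finset.sum_le_card_nsmul _ _ 1 fun t _ => ?_).trans (by simp)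
  by_cases hi : Integrable (fun x : (M × History (Round C D O) t) × ((C × D) × (O × ℝ)) =>
      task.mean x.1.1 (task.best x.1.1 x.2.1.1) x.2.1.1 - x.2.2.2)
      (task.gameLaw P agent t ⊗ₘ task.roundKernel P agent t)
  swap
  · rw [integral_undef hi]
    exact zero_le_one
  refine (integral_mono_ae hi (integrable_const 1) ?_).trans (by simp)
  have hs : MeasurableSet {x : (M × History (Round C D O) t) × ((C × D) × (O × ℝ)) |
      0 ≤ x.2.2.2} := measurableSet_le measurable_const (by fun_prop)
  have hpos : ∀ᵐ x ∂(task.gameLaw P agent t ⊗ₘ task.roundKernel P agent t),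
      0 ≤ x.2.2.2 := by
    refine (Measure.ae_compProd_iff hs).2 (Filter.Eventually.of_forall fun x => ?_)
    have hs' : MeasurableSet {y : (C × D) × (O × ℝ) | 0 ≤ y.2.2} :=
      measurableSet_le measurable_const (by fun_prop)
    rw [roundKernel, Kernel.compProd_apply_eq_compProd_sectR]
    refine (Measure.ae_compProd_iff hs').2 (Filter.Eventually.of_forall fun y => ?_)
    exact (task.reward_mem (x.1, y)).mono fun z hz => hz.1
  filter_upwards [hpos] with x hx
  have := task.mean_le_one x.1.1 (task.best x.1.1 x.2.1.1) x.2.1.1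
  linarith

theorem worstCaseRegret_le (task : DecisionTask M C D O) (notion : InfoNotion) (R : ℝ) (T : ℕ) :
    task.worstCaseRegret notion R T ≤ ((T : ℝ) : EReal) := by
  refine iSup₂_le fun P hP => ?_
  obtain ⟨agent, ha⟩ := hP
  exact iInf₂_le_of_le agent ha (EReal.coe_le_coe_iff.2 (task.bayesRegret_le P agent T))

end General

end DecisionTask

section Loss

variable {C D ι : Type*} [MeasurableSpace C] [MeasurableSpace D] {μ : ι → D → ℝ}

/-- The agent that always takes the decision `d`. -/
noncomputable def constantAgent (d : D) : Agent C D Bool where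
  policy _ := Kernel.const _ (Measure.dirac d)
  isMarkov _ := inferInstance

theorem trajectoryWeight_constantAgent [MeasurableSingletonClass D] {d₀ : D}
    (hd₀ : ∀ i j, μ i d₀ = μ j d₀) (c : C) (i j : ι) :
    ∀ t h, trajectoryWeight ((constantAgent (C := C) d₀).prob c) (μ i) t h =
      trajectoryWeight ((constantAgent (C := C) d₀).prob c) (μ j) t h
  | 0, _ => rfl
  | t + 1, h => by
    rw [trajectoryWeight, trajectoryWeight, trajectoryWeight_constantAgent hd₀ c i j t h.1]
    by_cases hd : h.2.1 = d₀
    · rw [hd, hd₀ i j]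
    · have : (constantAgent (C := C) d₀).prob c t h.1 h.2.1 = 0 := by
        simp [Agent.prob, constantAgent, Measure.real, Ne.symm hd]
      simp [this]

variable [Fintype D] [Fintype ι]

/-- The expectation, over the models and over the trajectories of `t` rounds, of a loss of the
decision in the next round. -/
noncomputable def expectedLoss (μ : ι → D → ℝ) (ℓ : ι → D → ℝ) (c : C)
    (agent : Agent C D Bool) (t : ℕ) : ℝ :=
  (Fintype.card ι : ℝ)⁻¹ * ∑ i, ∑ h, trajectoryWeight (agent.prob c) (μ i) t h *
    ∑ d, agent.prob c t h d * ℓ i d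

theorem expectedLoss_mono (hμ01 : ∀ i d, μ i d ∈ Set.Icc (0 : ℝ) 1) {ℓ ℓ' : ι → D → ℝ}
    (h : ∀ i d, ℓ i d ≤ ℓ' i d) (c : C) (agent : Agent C D Bool) (t : ℕ) :
    expectedLoss μ ℓ c agent t ≤ expectedLoss μ ℓ' c agent t := by
  refine mul_le_mul_of_nonneg_left (Finset.sum_le_sum fun i _ => Finset.sum_le_sum fun h' _ =>
    mul_le_mul_of_nonneg_left (Finset.sum_le_sum fun d _ =>
      mul_le_mul_of_nonneg_left (h i d) (agent.prob_nonneg c t h' d))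
      (trajectoryWeight_nonneg (agent.prob_nonneg c) (hμ01 i) t h')) (by positivity)

theorem expectedLoss_const_mul (a : ℝ) (ℓ : ι → D → ℝ) (c : C) (agent : Agent C D Bool) (t : ℕ) :
    expectedLoss μ (fun i d => a * ℓ i d) c agent t = a * expectedLoss μ ℓ c agent t := by
  simp only [expectedLoss, Finset.mul_sum]
  refine Finset.sum_congr rfl fun i _ => Finset.sum_congr rfl fun h _ =>
    Finset.sum_congr rfl fun d _ => by ring

end Loss

section FiniteFamily

variable {M C D ι : Type*} [MeasurableSpace M] [MeasurableSpace C] [MeasurableSpace D]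
  [Fintype D] [Nonempty D] [LinearOrder D]
  {f : M → D → C → ℝ} {hf : Measurable fun x : M × (C × D) => f x.1 x.2.2 x.2.1}
  {h01 : ∀ m d c, f m d c ∈ Set.Icc (0 : ℝ) 1} {mod : ι → M} {μ : ι → D → ℝ} {b : ι → D}

theorem best_eq (hμ : ∀ i d c, f (mod i) d c = μ i d) (hb : ∀ i d, d ≠ b i → μ i d < μ i (b i))
    (i : ι) (c : C) : (bernoulliTask f hf h01).best (mod i) c = b i := by
  refine DecisionTask.best_eq_of_forall_lt _ fun d hd => ?_
  rw [DecisionTask.mean_bernoulliTask, DecisionTask.mean_bernoulliTask, hμ, hμ]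
  exact hb i d hd

theorem map_best_uniformPrior [MeasurableSingletonClass M] [Fintype ι] [Nonempty ι]
    (hμ : ∀ i d c, f (mod i) d c = μ i d)
    (hb : ∀ i d, d ≠ b i → μ i d < μ i (b i)) (c c' : C) :
    (uniformPrior mod c : Measure (M × C)).fst.map
      (fun m => (bernoulliTask f hf h01).best m c') =
      atomic (fun _ => (Fintype.card ι : ℝ)⁻¹) b := by
  rw [uniformPrior_fst, map_atomic]
  congr 1
  funext i
  exact best_eq hμ hb i c'

variable [MeasurableSingletonClass D] [MeasurableSingletonClass M] [StandardBorelSpace C]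
  [Nonempty C] [MeasurableSingletonClass C] [Fintype ι] [Nonempty ι]

theorem bayesRegret_uniformPrior (hμ : ∀ i d c, f (mod i) d c = μ i d)
    (hb : ∀ i d, d ≠ b i → μ i d < μ i (b i)) (c : C) (agent : Agent C D Bool) (T : ℕ) :
    (bernoulliTask f hf h01).bayesRegret (uniformPrior mod c) agent T =
      ∑ t ∈ Finset.range T, expectedLoss μ (fun i d => μ i (b i) - μ i d) c agent t := by
  have hμ01 : ∀ i d, μ i d ∈ Set.Icc (0 : ℝ) 1 := fun i d => hμ i d c ▸ h01 _ _ _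
  have ha : ∀ t (k : ι × Trajectory D t), 0 ≤ (Fintype.card ι : ℝ)⁻¹ *
      trajectoryWeight (agent.prob c) (μ k.1) t k.2 := fun t k => mul_nonneg (by positivity)
    (trajectoryWeight_nonneg (agent.prob_nonneg c) (hμ01 k.1) t k.2)
  refine Finset.sum_congr rfl fun t _ => ?_
  rw [gameLaw_eq_atomic (fun i d => hμ i d c), atomic_compProd (ha t) _ _ _ _
    fun k => roundKernel_eq_atomic (fun i d => hμ i d c) agent t k.1 k.2, integral_atomic]
  swap
  · exact fun k => mul_nonneg (ha t k.1) (mul_nonneg (agent.prob_nonneg c _ _ _)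
      (likelihood_nonneg (hμ01 _ _) _))
  rw [Fintype.sum_prod_type, Fintype.sum_prod_type, expectedLoss, Finset.mul_sum]
  refine Finset.sum_congr rfl fun i _ => ?_
  rw [Finset.mul_sum]
  refine Finset.sum_congr rfl fun h _ => ?_
  rw [Fintype.sum_prod_type, Finset.mul_sum, Finset.mul_sum]
  refine Finset.sum_congr rfl fun d _ => ?_
  simp only [Fintype.sum_bool, likelihood, DecisionTask.mean_bernoulliTask]
  rw [best_eq hμ hb, hμ]
  simp
  ring

/-- The agent that samples its decision in every round from the law of `b i`, for uniform `i`; if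
`b i` is the optimal decision of `mod i`, this is the prior law of the optimal decision. -/
noncomputable def priorAgent (b : ι → D) : Agent C D Bool where
  policy _ := Kernel.const _ (atomic (fun _ => (Fintype.card ι : ℝ)⁻¹) b)
  isMarkov _ :=
    haveI := isProbabilityMeasure_atomic (a := fun _ => (Fintype.card ι : ℝ)⁻¹) b
      (fun _ => by positivity) (by simp)
    inferInstance

theorem map_best_gameLaw (hμ : ∀ i d c, f (mod i) d c = μ i d)
    (hb : ∀ i d, d ≠ b i → μ i d < μ i (b i)) (c : C) (agent : Agent C D Bool) (T : ℕ) :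
    ((bernoulliTask f hf h01).gameLaw (uniformPrior mod c) agent T).map
        (fun x => ((bernoulliTask f hf h01).best x.1, x.2)) =
      atomic (fun k : ι × Trajectory D T =>
          (Fintype.card ι : ℝ)⁻¹ * trajectoryWeight (agent.prob c) (μ k.1) T k.2)
        fun k => ((fun _ : C => b k.1), k.2.toHistory c) := by
  rw [gameLaw_eq_atomic (fun i d => hμ i d c), map_atomic]
  congr 1
  funext k
  exact Prod.ext (funext fun c' => best_eq hμ hb k.1 c') rfl

/-- If the mean reward of some decision does not depend on the model, then there are agents that
accumulate no information: one that always takes this decision learns nothing from its rewards,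
and one that samples from the prior law of the optimal decision never departs from it. -/
theorem exists_accumulatesAtMost (hμ : ∀ i d c, f (mod i) d c = μ i d)
    (hb : ∀ i d, d ≠ b i → μ i d < μ i (b i)) {d₀ : D} (hd₀ : ∀ i j, μ i d₀ = μ j d₀)
    (notion : InfoNotion) (c : C) (R : ℝ) (T : ℕ) :
    ∃ agent : Agent C D Bool,
      (bernoulliTask f hf h01).AccumulatesAtMost notion (uniformPrior mod c) R T agent := by
  have hμ01 : ∀ i d, μ i d ∈ Set.Icc (0 : ℝ) 1 := fun i d => hμ i d c ▸ h01 _ _ _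
  cases notion with
  | total =>
    refine ⟨constantAgent d₀, ?_⟩
    obtain ⟨j⟩ := ‹Nonempty ι›
    set agent : Agent C D Bool := constantAgent d₀
    have h1 := isProbabilityMeasure_atomic (a := fun _ : ι => (Fintype.card ι : ℝ)⁻¹)
      (fun i => (fun _ : C => b i)) (fun _ => by positivity) (by
        have : Nonempty ι := ⟨j⟩
        simp)
    have h2 := isProbabilityMeasure_atomic (a := trajectoryWeight (agent.prob c) (μ j) T)
      (fun h => h.toHistory c)
      (trajectoryWeight_nonneg (agent.prob_nonneg c) (hμ01 j) T)
      (sum_trajectoryWeight (agent.sum_prob c) T)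
    have hprod : ((bernoulliTask f hf h01).gameLaw (uniformPrior mod c) agent T).map
        (fun x => ((bernoulliTask f hf h01).best x.1, x.2)) =
        (atomic (fun _ : ι => (Fintype.card ι : ℝ)⁻¹) fun i => (fun _ : C => b i)).prod
          (atomic (trajectoryWeight (agent.prob c) (μ j) T) fun h => h.toHistory c) := by
      rw [map_best_gameLaw hμ hb, atomic_prod fun _ => by positivity]
      congr 1
      funext k
      rw [trajectoryWeight_constantAgent hd₀ c k.1 j]
    change DecisionTask.totalInfo _ _ _ _ ≤ _
    rw [DecisionTask.totalInfo, hprod, mutualInfoBits, Measure.fst_prod, Measure.snd_prod,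
      InformationTheory.klDiv_self]
    simp
  | perRound =>
    refine ⟨priorAgent b, fun t _ => ?_⟩
    rw [DecisionTask.roundInfo]
    refine le_of_eq_of_le ?_ zero_le
    simp_rw [map_best_uniformPrior hμ hb]
    simp [priorAgent, klBits]

end FiniteFamily

/-! ### Little information forces a large loss -/

theorem ofReal_div_log_two {r : ℝ} :
    ENNReal.ofReal (r / Real.log 2) = ENNReal.ofReal r / ENNReal.ofReal (Real.log 2) :=
  ENNReal.ofReal_div_of_pos (Real.log_pos one_lt_two)

section LowInformation

variable {M C D ι : Type*} [MeasurableSpace M] [MeasurableSpace C] [MeasurableSpace D]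
  [Fintype D] [Nonempty D] [LinearOrder D]
  [MeasurableSingletonClass D] [MeasurableSingletonClass M] [Countable C]
  [Nonempty C] [MeasurableSingletonClass C] [Fintype ι] [Nonempty ι]
  {f : M → D → C → ℝ} {hf : Measurable fun x : M × (C × D) => f x.1 x.2.2 x.2.1}
  {h01 : ∀ m d c, f m d c ∈ Set.Icc (0 : ℝ) 1} {mod : ι → M} {μ : ι → D → ℝ} {b : ι → D}

/-- The Donsker-Varadhan inequality for the joint law of optimal decision and history against
the product of its marginals, with `-s` times the loss in round `t` as the test function. -/
theorem le_expectedLoss_of_totalInfo_le (hμ : ∀ i d c, f (mod i) d c = μ i d)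
    (hb : ∀ i d, d ≠ b i → μ i d < μ i (b i)) (hinj : Function.Injective b) {ρ : ι → D → ℝ}
    {s κ : ℝ} (hρ : ∀ d, (Fintype.card ι : ℝ)⁻¹ * ∑ i, Real.exp (-s * ρ i d) ≤ Real.exp (-κ))
    {c : C} {R : ℝ} (hR : 0 ≤ R) {agent : Agent C D Bool} {t T : ℕ} (ht : t < T)
    (h : (bernoulliTask f hf h01).totalInfo (uniformPrior mod c) agent T ≤ ENNReal.ofReal R) :
    κ - R * Real.log 2 ≤ s * expectedLoss μ ρ c agent t := by
  have hμ01 : ∀ i d, μ i d ∈ Set.Icc (0 : ℝ) 1 := fun i d => hμ i d c ▸ h01 _ _ _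
  have : Inhabited D := Classical.inhabited_of_nonempty inferInstance
  have hN : 0 ≤ (Fintype.card ι : ℝ)⁻¹ := by positivity
  have hw : ∀ i h, 0 ≤ trajectoryWeight (agent.prob c) (μ i) T h := fun i =>
    trajectoryWeight_nonneg (agent.prob_nonneg c) (hμ01 i) T
  have ha : ∀ k : ι × Trajectory D T, 0 ≤ (Fintype.card ι : ℝ)⁻¹ *
      trajectoryWeight (agent.prob c) (μ k.1) T k.2 := fun k => mul_nonneg hN (hw _ _)
  rw [DecisionTask.totalInfo, map_best_gameLaw hμ hb] at h
  set J := atomic (fun k : ι × Trajectory D T =>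
      (Fintype.card ι : ℝ)⁻¹ * trajectoryWeight (agent.prob c) (μ k.1) T k.2)
    fun k => ((fun _ : C => b k.1), k.2.toHistory c) with hJ
  have hmarg : ∑ i : ι, ∑ h, (Fintype.card ι : ℝ)⁻¹ *
      trajectoryWeight (agent.prob c) (μ i) T h = 1 := by
    simp [← Finset.mul_sum, sum_trajectoryWeight (agent.sum_prob c)]
  have hJ1 : IsProbabilityMeasure J := isProbabilityMeasure_atomic _ ha (by
    rw [Fintype.sum_prod_type]; exact hmarg)
  have hfst : J.fst = atomic (fun _ : ι => (Fintype.card ι : ℝ)⁻¹) fun i => (fun _ : C => b i) := by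
    rw [Measure.fst, hJ, map_atomic_of_measurable _ _ measurable_fst]
    ext S hS
    rw [atomic_apply _ _ hS, atomic_apply _ _ hS, Fintype.sum_prod_type]
    refine Finset.sum_congr rfl fun i _ => ?_
    simp only [Function.comp]
    rw [← Finset.sum_mul, ← ENNReal.ofReal_sum_of_nonneg fun h _ => mul_nonneg hN (hw i h),
      ← Finset.mul_sum, sum_trajectoryWeight (agent.sum_prob c), mul_one]
  have hsnd : J.snd = atomic (fun k : ι × Trajectory D T =>
      (Fintype.card ι : ℝ)⁻¹ * trajectoryWeight (agent.prob c) (μ k.1) T k.2)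
      fun k => k.2.toHistory c := by
    rw [Measure.snd, hJ, map_atomic_of_measurable _ _ measurable_snd]
    rfl
  -- The index of the optimal decision is recovered from its value at `c`.
  let F : (C → D) × History (Round C D Bool) T → ℝ := fun x =>
    -s * ρ (Function.invFun b (x.1 c)) (decisionAt t T x.2)
  have hF : ∀ i h, F (fun _ => b i, h) = -s * ρ i (decisionAt t T h) := fun i h => by
    simp only [F, Function.leftInverse_invFun hinj i]
  have hprod := atomic_prod (fun _ => hN) (fun i : ι => (fun _ : C => b i))
    (fun k : ι × Trajectory D T =>
      (Fintype.card ι : ℝ)⁻¹ * trajectoryWeight (agent.prob c) (μ k.1) T k.2)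
    fun k => k.2.toHistory c
  rw [← hfst, ← hsnd] at hprod
  have hFJ : ∫ x, F x ∂J = -(s * expectedLoss μ ρ c agent t) := by
    rw [hJ, integral_atomic ha, Fintype.sum_prod_type, expectedLoss, Finset.mul_sum,
      Finset.mul_sum, ← Finset.sum_neg_distrib]
    refine Finset.sum_congr rfl fun i _ => ?_
    rw [← sum_trajectoryWeight_mul_decisionAt c (agent.sum_prob c) (ρ i) ht, Finset.mul_sum,
      Finset.mul_sum, ← Finset.sum_neg_distrib]
    refine Finset.sum_congr rfl fun h _ => ?_
    rw [hF]
    ring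
  have hFprod : ∫ x, Real.exp (F x) ∂(J.fst.prod J.snd) ≤ Real.exp (-κ) := by
    rw [hprod, integral_atomic fun k : ι × ι × Trajectory D T => mul_nonneg hN (ha k.2),
      Fintype.sum_prod_type_right]
    calc _ ≤ ∑ k : ι × Trajectory D T, ((Fintype.card ι : ℝ)⁻¹ *
          trajectoryWeight (agent.prob c) (μ k.1) T k.2) * Real.exp (-κ) := by
          refine Finset.sum_le_sum fun k _ => ?_
          refine le_of_eq_of_le ?_ (mul_le_mul_of_nonneg_left
            (hρ (decisionAt t T (k.2.toHistory c))) (ha k))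
          rw [Finset.mul_sum, Finset.mul_sum]
          refine Finset.sum_congr rfl fun i _ => ?_
          rw [hF]
          ring
      _ = Real.exp (-κ) := by
          rw [← Finset.sum_mul, Fintype.sum_prod_type, hmarg, one_mul]
  have hDV := ofReal_integral_add_le_klDiv J (J.fst.prod J.snd) (F := F)
    (integrable_atomic _ _ _) (by rw [hprod]; exact integrable_atomic _ _ _) hFprod
  have hle := (ENNReal.div_le_div_right hDV _).trans h
  rw [← ofReal_div_log_two, ENNReal.ofReal_le_ofReal_iff hR,
    div_le_iff₀ (Real.log_pos one_lt_two), hFJ] at hle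
  linarith

/-- The Donsker-Varadhan inequality for the stochastic decision in round `t` against the prior
law of the optimal decision, with `-s` times the loss as the test function. -/
theorem le_expectedLoss_of_roundInfo_le (hμ : ∀ i d c, f (mod i) d c = μ i d)
    (hb : ∀ i d, d ≠ b i → μ i d < μ i (b i)) {ρ : ι → D → ℝ}
    {s κ : ℝ}
    (hρ : ∀ i, (Fintype.card ι : ℝ)⁻¹ * ∑ j, Real.exp (-s * ρ i (b j)) ≤ Real.exp (-κ))
    {c : C} {R : ℝ} (hR : 0 ≤ R) {agent : Agent C D Bool} {t : ℕ}
    (h : (bernoulliTask f hf h01).roundInfo (uniformPrior mod c) agent t ≤ ENNReal.ofReal R) :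
    κ - R * Real.log 2 ≤ s * expectedLoss μ ρ c agent t := by
  have hμ01 : ∀ i d, μ i d ∈ Set.Icc (0 : ℝ) 1 := fun i d => hμ i d c ▸ h01 _ _ _
  have hN : 0 ≤ (Fintype.card ι : ℝ)⁻¹ := by positivity
  have ha : ∀ k : ι × Trajectory D t, 0 ≤ (Fintype.card ι : ℝ)⁻¹ *
      trajectoryWeight (agent.prob c) (μ k.1) t k.2 := fun k => mul_nonneg hN
    (trajectoryWeight_nonneg (agent.prob_nonneg c) (hμ01 k.1) t k.2)
  have hsum : ∑ k : ι × Trajectory D t, (Fintype.card ι : ℝ)⁻¹ *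
      trajectoryWeight (agent.prob c) (μ k.1) t k.2 = 1 := by
    rw [Fintype.sum_prod_type]
    simp [← Finset.mul_sum, sum_trajectoryWeight (agent.sum_prob c)]
  have hb1 := isProbabilityMeasure_atomic (a := fun _ : ι => (Fintype.card ι : ℝ)⁻¹) b
    (fun _ => hN) (by simp)
  have hterm : ∀ k : ι × Trajectory D t,
      ENNReal.ofReal ((κ - s * ∑ d, agent.prob c t k.2 d * ρ k.1 d) / Real.log 2) ≤
        klBits (agent.policy t (k.2.toHistory c, c))
          (atomic (fun _ : ι => (Fintype.card ι : ℝ)⁻¹) b) := fun k => by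
    have hp : agent.policy t (k.2.toHistory c, c) = atomic (agent.prob c t k.2) id :=
      eq_atomic_real _
    have hDV := ofReal_integral_add_le_klDiv (agent.policy t (k.2.toHistory c, c))
      (atomic (fun _ : ι => (Fintype.card ι : ℝ)⁻¹) b) (F := fun d => -s * ρ k.1 d) (κ := κ)
      (by rw [hp]; exact integrable_atomic _ _ _) (integrable_atomic _ _ _)
      (by rw [integral_atomic fun _ => hN, ← Finset.mul_sum]; exact hρ k.1)
    rw [ofReal_div_log_two]
    refine ENNReal.div_le_div_right (le_of_eq_of_le ?_ hDV) _
    rw [hp, integral_atomic (agent.prob_nonneg c t k.2), Finset.mul_sum]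
    congr 1
    rw [sub_eq_neg_add, ← Finset.sum_neg_distrib]
    congr 1
    exact Finset.sum_congr rfl fun d _ => by simp; ring
  rw [DecisionTask.roundInfo, gameLaw_eq_atomic (fun i d => hμ i d c),
    atomic_compProd (J' := Unit) ha _ _ (fun _ _ => 1) (fun _ _ => c)
      fun k => by simp [contextKernel_uniformPrior, atomic],
    lintegral_atomic, Fintype.sum_prod_type] at h
  simp only [map_best_uniformPrior hμ hb, Finset.univ_unique, Finset.sum_singleton,
    mul_one] at h
  have hle : ENNReal.ofReal (∑ k : ι × Trajectory D t, ((Fintype.card ι : ℝ)⁻¹ *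
      trajectoryWeight (agent.prob c) (μ k.1) t k.2) *
        ((κ - s * ∑ d, agent.prob c t k.2 d * ρ k.1 d) / Real.log 2)) ≤ ENNReal.ofReal R := by
    refine (Finset.le_sum_of_subadditive ENNReal.ofReal ENNReal.ofReal_zero.le
      (fun _ _ => ENNReal.ofReal_add_le) _ _).trans (le_trans (Finset.sum_le_sum fun k _ => ?_) h)
    rw [ENNReal.ofReal_mul (ha k)]
    exact mul_le_mul_right (hterm k) _
  rw [ENNReal.ofReal_le_ofReal_iff hR] at hle
  simp_rw [← mul_div_assoc] at hle
  rw [← Finset.sum_div, div_le_iff₀ (Real.log_pos one_lt_two)] at hle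
  have heq : ∑ k : ι × Trajectory D t, ((Fintype.card ι : ℝ)⁻¹ *
      trajectoryWeight (agent.prob c) (μ k.1) t k.2) *
        (κ - s * ∑ d, agent.prob c t k.2 d * ρ k.1 d) = κ - s * expectedLoss μ ρ c agent t := by
    simp_rw [mul_sub]
    rw [Finset.sum_sub_distrib, ← Finset.sum_mul, hsum, one_mul, expectedLoss,
      Fintype.sum_prod_type]
    simp only [Finset.mul_sum]
    congr 1
    refine Finset.sum_congr rfl fun i _ => Finset.sum_congr rfl fun h _ =>
      Finset.sum_congr rfl fun d _ => by ring
  linarith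

/-- The regret is linear in `T`, if the mean reward of the optimal decision exceeds that of
every other decision by at least `γ` times a loss `ρ`, and if a decision chosen without
knowledge of the model incurs a large loss with high probability, as measured by `κ`. -/
theorem le_worstCaseRegret_of_low_information (hμ : ∀ i d c, f (mod i) d c = μ i d)
    (hb : ∀ i d, d ≠ b i → μ i d < μ i (b i)) (hinj : Function.Injective b)
    {d₀ : D} (hd₀ : ∀ i j, μ i d₀ = μ j d₀) {ρ : ι → D → ℝ} {s κ γ : ℝ} (hs : 0 < s) (hγ : 0 ≤ γ)
    (hgap : ∀ i d, γ * ρ i d ≤ μ i (b i) - μ i d)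
    (hρ : ∀ d, (Fintype.card ι : ℝ)⁻¹ * ∑ i, Real.exp (-s * ρ i d) ≤ Real.exp (-κ))
    (hρ' : ∀ i, (Fintype.card ι : ℝ)⁻¹ * ∑ j, Real.exp (-s * ρ i (b j)) ≤ Real.exp (-κ))
    (notion : InfoNotion) {R : ℝ} (hR : 0 ≤ R) (T : ℕ) :
    ((T * (γ * ((κ - R * Real.log 2) / s)) : ℝ) : EReal) ≤
      (bernoulliTask f hf h01).worstCaseRegret notion R T := by
  obtain ⟨c⟩ := ‹Nonempty C›
  have : Nonempty C := ⟨c⟩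
  have hμ01 : ∀ i d, μ i d ∈ Set.Icc (0 : ℝ) 1 := fun i d => hμ i d c ▸ h01 _ _ _
  refine DecisionTask.le_worstCaseRegret _ (uniformPrior mod c)
    (exists_accumulatesAtMost hμ hb hd₀ notion c R T) fun agent hagent => ?_
  rw [bayesRegret_uniformPrior hμ hb]
  have hle : ∀ t < T, κ - R * Real.log 2 ≤ s * expectedLoss μ ρ c agent t := fun t ht => by
    cases notion with
    | total => exact le_expectedLoss_of_totalInfo_le hμ hb hinj hρ hR ht hagent
    | perRound => exact le_expectedLoss_of_roundInfo_le hμ hb hρ' hR (hagent t ht)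
  refine le_of_eq_of_le (by simp) (Finset.card_nsmul_le_sum (Finset.range T) _
    (γ * ((κ - R * Real.log 2) / s)) fun t ht => ?_)
  refine le_trans ?_ (expectedLoss_mono hμ01 hgap c agent t)
  rw [expectedLoss_const_mul]
  refine mul_le_mul_of_nonneg_left ?_ hγ
  rw [div_le_iff₀' hs]
  exact hle t (Finset.mem_range.1 ht)

end LowInformation

/-! ### Small gaps force a large loss -/

section LikelihoodRatio

variable {D : Type*} [DecidableEq D]

/-- The logarithm of the likelihood ratio of a trajectory between the arm means `μ` and `β`, when
these differ at most at the arm `d₀`. -/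
noncomputable def logRatio (μ β : D → ℝ) (d₀ : D) : ∀ t, Trajectory D t → ℝ
  | 0, _ => 0
  | t + 1, h => logRatio μ β d₀ t h.1 + if h.2.1 = d₀ then
      Real.log (likelihood (μ d₀) h.2.2 / likelihood (β d₀) h.2.2) else 0

variable {μ β : D → ℝ} {d₀ : D} {q : ∀ t, Trajectory D t → D → ℝ}

theorem trajectoryWeight_eq_mul_exp_logRatio (hne : ∀ d, d ≠ d₀ → μ d = β d)
    (hμ : ∀ o, 0 < likelihood (μ d₀) o) (hβ : ∀ o, 0 < likelihood (β d₀) o) :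
    ∀ t h, trajectoryWeight q μ t h = trajectoryWeight q β t h * Real.exp (logRatio μ β d₀ t h)
  | 0, _ => by simp [trajectoryWeight, logRatio]
  | t + 1, h => by
    rw [trajectoryWeight, trajectoryWeight, logRatio,
      trajectoryWeight_eq_mul_exp_logRatio hne hμ hβ t h.1, Real.exp_add]
    by_cases hd : h.2.1 = d₀
    · rw [if_pos hd, Real.exp_log (div_pos (hμ _) (hβ _)), hd]
      have := (hβ h.2.2).ne'
      field_simp
    · rw [if_neg hd, hne _ hd, Real.exp_zero]
      ring

/-- Up to sign, the left side is the divergence of two Bernoulli laws; it is bounded by the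
`χ²`-divergence. -/
theorem neg_le_sum_likelihood_mul_log {p r δ : ℝ} (hp : p ∈ Set.Icc (1 / 4 : ℝ) (3 / 4))
    (hr : r ∈ Set.Icc (1 / 4 : ℝ) (3 / 4)) (hδ : |r - p| ≤ 2 * δ) :
    -(22 * δ ^ 2) ≤ ∑ o, likelihood p o * Real.log (likelihood r o / likelihood p o) := by
  obtain ⟨hp1, hp2⟩ := hp
  obtain ⟨hr1, hr2⟩ := hr
  have hlog : ∀ x y : ℝ, 0 < x → 0 < y → x * (1 - x / y) ≤ x * Real.log (y / x) := by
    intro x y hx hy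
    refine mul_le_mul_of_nonneg_left ?_ hx.le
    have := Real.one_sub_inv_le_log_of_pos (div_pos hy hx)
    rwa [inv_div] at this
  have h1 := hlog p r (by linarith) (by linarith)
  have h2 := hlog (1 - p) (1 - r) (by linarith) (by linarith)
  have h3 : p * (1 - p / r) + (1 - p) * (1 - (1 - p) / (1 - r)) =
      -((r - p) ^ 2 / (r * (1 - r))) := by
    have : r ≠ 0 := by linarith
    have : 1 - r ≠ 0 := by linarith
    field_simp
    ring
  have h4 : (r - p) ^ 2 ≤ (2 * δ) ^ 2 := sq_le_sq' (by linarith [abs_le.1 hδ]) (abs_le.1 hδ).2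
  have h5 : 3 / 16 ≤ r * (1 - r) := by nlinarith
  have h6 : (r - p) ^ 2 / (r * (1 - r)) ≤ 22 * δ ^ 2 := by
    rw [div_le_iff₀ (by linarith)]
    nlinarith [sq_nonneg δ]
  simp only [Fintype.sum_bool, likelihood, if_true, Bool.false_eq_true, if_false]
  linarith

variable [Fintype D]

/-- Under the arm means `β`, the log-likelihood ratio decreases in expectation by at most `ε`
whenever the arm `d₀` is pulled. -/
theorem neg_le_sum_trajectoryWeight_mul_logRatio (hq : ∀ t h d, 0 ≤ q t h d)
    (hq1 : ∀ t h, ∑ d, q t h d = 1) (hβ01 : ∀ d, β d ∈ Set.Icc (0 : ℝ) 1) {ε : ℝ}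
    (hε : -ε ≤ ∑ o, likelihood (β d₀) o *
      Real.log (likelihood (μ d₀) o / likelihood (β d₀) o)) (t : ℕ) :
    -(ε * ∑ s ∈ Finset.range t, ∑ h, trajectoryWeight q β s h * q s h d₀) ≤
      ∑ h, trajectoryWeight q β t h * logRatio μ β d₀ t h := by
  induction t with
  | zero => simp [logRatio]
  | succ t ih =>
    rw [Trajectory.sum_succ]
    have hstep : ∀ h : Trajectory D t, ∑ d, ∑ o, trajectoryWeight q β (t + 1) (h, (d, o)) *
        logRatio μ β d₀ (t + 1) (h, (d, o)) =
        trajectoryWeight q β t h * logRatio μ β d₀ t h +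
          trajectoryWeight q β t h * q t h d₀ * ∑ o, likelihood (β d₀) o *
            Real.log (likelihood (μ d₀) o / likelihood (β d₀) o) := by
      intro h
      have hd : ∀ d, ∑ o, trajectoryWeight q β (t + 1) (h, (d, o)) *
          logRatio μ β d₀ (t + 1) (h, (d, o)) =
          trajectoryWeight q β t h * logRatio μ β d₀ t h * q t h d +
            if d = d₀ then trajectoryWeight q β t h * q t h d₀ * ∑ o, likelihood (β d₀) o *
            Real.log (likelihood (μ d₀) o / likelihood (β d₀) o) else 0 := by
        intro d
        simp only [trajectoryWeight, logRatio]
        by_cases hdd : d = d₀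
        · subst hdd
          simp only [if_true]
          have := sum_likelihood (β d)
          simp only [Fintype.sum_bool] at this ⊢
          linear_combination (trajectoryWeight q β t h * logRatio μ β d t h * q t h d) * this
        · simp only [if_neg hdd, add_zero]
          have := sum_likelihood (β d)
          simp only [Fintype.sum_bool] at this ⊢
          linear_combination (trajectoryWeight q β t h * logRatio μ β d₀ t h * q t h d) * this
      simp only [hd, Finset.sum_add_distrib, ← Finset.mul_sum, hq1, Finset.sum_ite_eq',
        Finset.mem_univ, if_true, mul_one]
    simp only [hstep, Finset.sum_add_distrib, ← Finset.sum_mul]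
    rw [Finset.sum_range_succ, mul_add, neg_add]
    refine add_le_add ih ?_
    have h0 : 0 ≤ ∑ h, trajectoryWeight q β t h * q t h d₀ :=
      Finset.sum_nonneg fun h _ => mul_nonneg (trajectoryWeight_nonneg hq hβ01 t h) (hq t h d₀)
    nlinarith [mul_le_mul_of_nonneg_left hε h0]

end LikelihoodRatio

section SmallGaps

variable {C D ι : Type*} [MeasurableSpace C] [MeasurableSpace D]
  [Fintype D] [DecidableEq D] [MeasurableSingletonClass D] [Fintype ι]
  {μ : ι → D → ℝ} {b : ι → D} {β : D → ℝ}

/-- A change of measure from the models `μ i` to the common arm means `β`. The likelihood ratio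
`L` satisfies `1 + log L ≤ L` and `log L ≤ L / e`. Since the arms `b i` are distinct, their
probabilities under `β` add up to at most one, and so do the divergences, up to a factor. -/
theorem le_expectedLoss_of_smallGaps (hinj : Function.Injective b)
    (hμ01 : ∀ i d, μ i d ∈ Set.Icc (0 : ℝ) 1) (hβ01 : ∀ d, β d ∈ Set.Icc (0 : ℝ) 1)
    (hne : ∀ i d, d ≠ b i → μ i d = β d)
    (hμb : ∀ i, μ i (b i) ∈ Set.Icc (1 / 4 : ℝ) (3 / 4))
    (hβb : ∀ i, β (b i) ∈ Set.Icc (1 / 4 : ℝ) (3 / 4))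
    {Δ : ℝ} (hΔ : ∀ i, |μ i (b i) - β (b i)| ≤ 2 * Δ) (hN : 2 ≤ Fintype.card ι) {T : ℕ}
    (hT : 22 * Δ ^ 2 * T ≤ Fintype.card ι / 40) (c : C) (agent : Agent C D Bool) {t : ℕ}
    (ht : t < T) :
    1 / 10 ≤ expectedLoss μ (fun i d => if d = b i then 0 else 1) c agent t := by
  set q := agent.prob c with hq
  have hq0 : ∀ t h d, 0 ≤ q t h d := agent.prob_nonneg c
  have hq1 : ∀ t h, ∑ d, q t h d = 1 := agent.sum_prob c
  have hlik : ∀ p ∈ Set.Icc (1 / 4 : ℝ) (3 / 4), ∀ o, 0 < likelihood p o := by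
    rintro p ⟨h1, h2⟩ (_ | _) <;> simp only [likelihood, if_true, Bool.false_eq_true, if_false] <;>
      linarith
  have hw0 : ∀ s h, 0 ≤ trajectoryWeight q β s h := trajectoryWeight_nonneg hq0 hβ01
  have hw1 : ∀ s, ∑ h, trajectoryWeight q β s h = 1 := sum_trajectoryWeight hq1
  have hα : ∀ s, ∑ i, ∑ h, trajectoryWeight q β s h * q s h (b i) ≤ 1 := by
    intro s
    rw [Finset.sum_comm, ← hw1 s]
    refine Finset.sum_le_sum fun h _ => ?_
    rw [← Finset.mul_sum]
    refine mul_le_of_le_one_right (hw0 s h) ?_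
    rw [← hq1 s h, ← Finset.sum_image (f := fun d => q s h d) fun i _ j _ hij => hinj hij]
    exact Finset.sum_le_sum_of_subset_of_nonneg (Finset.subset_univ _) fun d _ _ => hq0 s h d
  have hloss : ∀ i h, ∑ d, q t h d * (if d = b i then (0 : ℝ) else 1) = 1 - q t h (b i) := by
    intro i h
    have hd : ∀ d, q t h d * (if d = b i then (0 : ℝ) else 1) =
        q t h d - if d = b i then q t h d else 0 := fun d => by split_ifs <;> ring
    simp [hd, hq1]
  have hpoint : ∀ x α : ℝ, 0 ≤ α → α ≤ 1 →
      (1 - α) + x - α * Real.exp x * Real.exp (-1) ≤ Real.exp x * (1 - α) := by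
    intro x α h0 h1
    have e1 := mul_le_mul_of_nonneg_left (Real.add_one_le_exp x) (sub_nonneg.2 h1)
    have e2 := mul_le_mul_of_nonneg_left (Real.add_one_le_exp (x - 1)) h0
    rw [Real.exp_sub] at e2
    rw [Real.exp_neg, mul_assoc, ← div_eq_mul_inv]
    linarith
  have hterm : ∀ i, 1 - ∑ h, trajectoryWeight q β t h * q t h (b i) -
      22 * Δ ^ 2 * ∑ s ∈ Finset.range t, ∑ h, trajectoryWeight q β s h * q s h (b i) -
      Real.exp (-1) ≤ ∑ h, trajectoryWeight q (μ i) t h * (1 - q t h (b i)) := by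
    intro i
    set L := logRatio (μ i) β (b i) t
    have hw := trajectoryWeight_eq_mul_exp_logRatio (q := q) (hne i) (hlik _ (hμb i))
      (hlik _ (hβb i)) t
    have hlog := neg_le_sum_trajectoryWeight_mul_logRatio hq0 hq1 hβ01
      (neg_le_sum_likelihood_mul_log (hβb i) (hμb i) (hΔ i)) t
    have hq_le : ∀ h, q t h (b i) ≤ 1 := fun h => by
      rw [← hq1 t h]
      exact Finset.single_le_sum (fun d _ => hq0 t h d) (Finset.mem_univ _)
    have hwi0 : ∀ h, 0 ≤ trajectoryWeight q (μ i) t h := trajectoryWeight_nonneg hq0 (hμ01 i) t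
    have hle1 : ∑ h, trajectoryWeight q (μ i) t h * q t h (b i) ≤ 1 := by
      rw [← sum_trajectoryWeight (μ := μ i) hq1 t]
      exact Finset.sum_le_sum fun h _ => mul_le_of_le_one_right (hwi0 h) (hq_le h)
    have hsum : ∑ h, (trajectoryWeight q β t h - trajectoryWeight q β t h * q t h (b i) +
        trajectoryWeight q β t h * L h -
        trajectoryWeight q (μ i) t h * q t h (b i) * Real.exp (-1)) ≤
        ∑ h, trajectoryWeight q (μ i) t h * (1 - q t h (b i)) := by
      refine Finset.sum_le_sum fun h _ => ?_
      have := mul_le_mul_of_nonneg_left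
        (hpoint (L h) (q t h (b i)) (hq0 t h _) (hq_le h)) (hw0 t h)
      rw [hw h]
      linarith
    rw [Finset.sum_sub_distrib, Finset.sum_add_distrib, Finset.sum_sub_distrib, hw1,
      ← Finset.sum_mul] at hsum
    have := mul_le_mul_of_nonneg_right hle1 (Real.exp_pos (-1)).le
    linarith
  have hsumi := Finset.sum_le_sum fun i (_ : i ∈ Finset.univ) => hterm i
  simp only [Finset.sum_sub_distrib, ← Finset.mul_sum, Finset.sum_const, Finset.card_univ,
    nsmul_eq_mul, mul_one] at hsumi
  rw [Finset.sum_comm (s := Finset.univ) (t := Finset.range t)] at hsumi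
  have hα_sum : ∑ s ∈ Finset.range t, ∑ i, ∑ h, trajectoryWeight q β s h * q s h (b i) ≤ T := by
    refine (Finset.sum_le_sum fun s _ => hα s).trans ?_
    simpa using (Nat.cast_le (α := ℝ)).2 ht.le
  have hKL := mul_le_mul_of_nonneg_left hα_sum (by positivity : 0 ≤ 22 * Δ ^ 2)
  have he := Real.exp_neg_one_lt_d9
  have hN' : (2 : ℝ) ≤ Fintype.card ι := by exact_mod_cast hN
  have hαt := hα t
  rw [expectedLoss, ← hq]
  simp only [hloss]
  rw [inv_mul_eq_div, le_div_iff₀ (by linarith)]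
  have hNe : (Fintype.card ι : ℝ) * Real.exp (-1) ≤ Fintype.card ι * 0.3678794412 :=
    mul_le_mul_of_nonneg_left he.le (by linarith)
  linarith

end SmallGaps

/-- The regret with gaps of size `Δ`, if these are so small that `T` rounds do not suffice to
tell the models apart. -/
theorem le_worstCaseRegret_of_smallGaps {M C D ι : Type*} [MeasurableSpace M] [MeasurableSpace C]
    [MeasurableSpace D] [Fintype D] [Nonempty D] [LinearOrder D] [MeasurableSingletonClass D]
    [MeasurableSingletonClass M] [StandardBorelSpace C] [Nonempty C] [Fintype ι] [Nonempty ι]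
    [MeasurableSingletonClass C]
    {f : M → D → C → ℝ} {hf : Measurable fun x : M × (C × D) => f x.1 x.2.2 x.2.1}
    {h01 : ∀ m d c, f m d c ∈ Set.Icc (0 : ℝ) 1} {mod : ι → M} {μ : ι → D → ℝ} {b : ι → D}
    {β : D → ℝ} (hμ : ∀ i d c, f (mod i) d c = μ i d) (hinj : Function.Injective b)
    {d₀ : D} (hd₀ : ∀ i j, μ i d₀ = μ j d₀) (hβ01 : ∀ d, β d ∈ Set.Icc (0 : ℝ) 1)
    (hne : ∀ i d, d ≠ b i → μ i d = β d)
    (hμb : ∀ i, μ i (b i) ∈ Set.Icc (1 / 4 : ℝ) (3 / 4))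
    (hβb : ∀ i, β (b i) ∈ Set.Icc (1 / 4 : ℝ) (3 / 4))
    {Δ : ℝ} (hΔ0 : 0 < Δ) (hΔ : ∀ i, |μ i (b i) - β (b i)| ≤ 2 * Δ)
    (hgap : ∀ i d, d ≠ b i → Δ ≤ μ i (b i) - μ i d) (hN : 2 ≤ Fintype.card ι) {T : ℕ}
    (hT : 22 * Δ ^ 2 * T ≤ Fintype.card ι / 40) (notion : InfoNotion) (R : ℝ) :
    ((T * (Δ * (1 / 10)) : ℝ) : EReal) ≤
      (bernoulliTask f hf h01).worstCaseRegret notion R T := by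
  obtain ⟨c⟩ := ‹Nonempty C›
  have : Nonempty C := ⟨c⟩
  have hμ01 : ∀ i d, μ i d ∈ Set.Icc (0 : ℝ) 1 := fun i d => hμ i d c ▸ h01 _ _ _
  have hb : ∀ i d, d ≠ b i → μ i d < μ i (b i) := fun i d hd => by linarith [hgap i d hd]
  refine DecisionTask.le_worstCaseRegret _ (uniformPrior mod c)
    (exists_accumulatesAtMost hμ hb hd₀ notion c R T) fun agent _ => ?_
  rw [bayesRegret_uniformPrior hμ hb]
  refine le_of_eq_of_le (by simp) (Finset.card_nsmul_le_sum (Finset.range T) _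
    (Δ * (1 / 10)) fun t ht => ?_)
  refine (mul_le_mul_of_nonneg_left (le_expectedLoss_of_smallGaps hinj hμ01 hβ01 hne hμb hβb hΔ
    hN hT c agent (Finset.mem_range.1 ht)) hΔ0.le).trans ?_
  rw [← expectedLoss_const_mul]
  refine expectedLoss_mono hμ01 (fun i d => ?_) c agent t
  split_ifs with hd
  · simp [hd]
  · simpa using hgap i d hd

/-! ### One good arm among many -/

/-- The constant `3 / 4 < 1` is what makes the loss of an uninformed decision visible for small
`N` as well: for `N = 2` the ratio of the logarithms is about `0.585`. -/
theorem log_two_sub_inv_le {N : ℕ} (hN : 2 ≤ N) :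
    Real.log (2 - (N : ℝ)⁻¹) ≤ 3 / 4 * Real.log N := by
  have hN' : (2 : ℝ) ≤ N := by exact_mod_cast hN
  have hinv : (N : ℝ)⁻¹ ≤ 1 / 2 := by
    rw [one_div]
    exact inv_anti₀ two_pos hN'
  have hpos : 0 < (N : ℝ)⁻¹ := by positivity
  have h : (2 - (N : ℝ)⁻¹) ^ 4 ≤ (N : ℝ) ^ 3 := by
    rcases hN.eq_or_lt with rfl | h3
    · norm_num
    · have h3' : (3 : ℝ) ≤ N := by exact_mod_cast h3
      calc (2 - (N : ℝ)⁻¹) ^ 4 ≤ 2 ^ 4 := pow_le_pow_left₀ (by linarith) (by linarith) 4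
        _ ≤ 3 ^ 3 := by norm_num
        _ ≤ (N : ℝ) ^ 3 := pow_le_pow_left₀ (by norm_num) h3' 3
  have := Real.log_le_log (by apply pow_pos; linarith) h
  rw [Real.log_pow, Real.log_pow] at this
  push_cast at this
  linarith

section Needle

variable {ι D : Type*} [DecidableEq D]

open Classical in
/-- Arm means in which the arm `b i` has the mean `1/2 + Δ`, all other arms `b j` have the mean
`1/2 - Δ`, and the remaining arms `d` have the mean `v d`. The arm `b i₀` is an exception: it has
the mean `1/2` for all `i`, so that its rewards carry no information on `i`. -/
noncomputable def needleMean (b : ι → D) (i₀ : ι) (v : D → ℝ) (Δ : ℝ) (i : ι) (d : D) : ℝ :=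
  (if d = b i₀ then 1 / 2 else if d ∈ Set.range b then 1 / 2 - Δ else v d) +
    if d = b i ∧ d ≠ b i₀ then 2 * Δ else 0

variable {b : ι → D} {i₀ : ι} {v : D → ℝ} {Δ : ℝ}

theorem needleMean_base_arm (i : ι) : needleMean b i₀ v Δ i (b i₀) = 1 / 2 := by
  simp [needleMean]

theorem needleMean_of_ne {i : ι} {d : D} (hd : d ≠ b i) :
    needleMean b i₀ v Δ i d = needleMean b i₀ v Δ i₀ d := by
  simp only [needleMean, hd, false_and, if_false]
  by_cases h : d = b i₀ <;> simp [h]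

theorem needleMean_base {i : ι} (hi : b i ≠ b i₀) :
    needleMean b i₀ v Δ i₀ (b i) = 1 / 2 - Δ := by
  simp [needleMean, hi]

theorem needleMean_self {i : ι} (hi : b i ≠ b i₀) :
    needleMean b i₀ v Δ i (b i) = 1 / 2 + Δ := by
  simp [needleMean, hi]
  ring

theorem needleMean_of_notMem (i : ι) {d : D} (hd : d ∉ Set.range b) :
    needleMean b i₀ v Δ i d = v d := by
  have h : ∀ j, d ≠ b j := fun j hj => hd ⟨j, hj.symm⟩
  rw [needleMean, if_neg (h i₀), if_neg hd, if_neg fun hc => h i hc.1, add_zero]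

theorem needleMean_base_mem (hΔ : Δ ∈ Set.Ioc (0 : ℝ) (1 / 4)) (i : ι) :
    needleMean b i₀ v Δ i₀ (b i) ∈ Set.Icc (1 / 4 : ℝ) (1 / 2) := by
  obtain ⟨h1, h2⟩ := hΔ
  by_cases hi : b i = b i₀
  · rw [hi, needleMean_base_arm]
    norm_num
  · rw [needleMean_base hi]
    constructor <;> linarith

theorem needleMean_self_mem (hΔ : Δ ∈ Set.Ioc (0 : ℝ) (1 / 4)) (i : ι) :
    needleMean b i₀ v Δ i (b i) ∈ Set.Icc (1 / 2 : ℝ) (3 / 4) := by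
  obtain ⟨h1, h2⟩ := hΔ
  by_cases hi : b i = b i₀
  · rw [hi, needleMean_base_arm]
    norm_num
  · rw [needleMean_self hi]
    constructor <;> linarith

theorem needleMean_base_mem_Icc (hΔ : Δ ∈ Set.Ioc (0 : ℝ) (1 / 4))
    (hv : ∀ d, v d ∈ Set.Icc (0 : ℝ) (1 / 4)) (d : D) :
    needleMean b i₀ v Δ i₀ d ∈ Set.Icc (0 : ℝ) (1 / 2) := by
  by_cases hd : d ∈ Set.range b
  · obtain ⟨i, rfl⟩ := hd
    have := needleMean_base_mem (b := b) (i₀ := i₀) (v := v) hΔ i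
    exact ⟨by linarith [this.1], this.2⟩
  · rw [needleMean_of_notMem _ hd]
    exact ⟨(hv d).1, by linarith [(hv d).2]⟩

theorem needleMean_mem_Icc (hΔ : Δ ∈ Set.Ioc (0 : ℝ) (1 / 4))
    (hv : ∀ d, v d ∈ Set.Icc (0 : ℝ) (1 / 4)) (i : ι) (d : D) :
    needleMean b i₀ v Δ i d ∈ Set.Icc (0 : ℝ) 1 := by
  by_cases hd : d = b i
  · have := needleMean_self_mem (b := b) (i₀ := i₀) (v := v) hΔ i
    rw [hd]
    exact ⟨by linarith [this.1], by linarith [this.2]⟩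
  · rw [needleMean_of_ne hd]
    have := needleMean_base_mem_Icc (b := b) (i₀ := i₀) hΔ hv d
    exact ⟨this.1, by linarith [this.2]⟩

theorem le_needleMean_sub (hΔ : Δ ∈ Set.Ioc (0 : ℝ) (1 / 4))
    (hv : ∀ d, v d ∈ Set.Icc (0 : ℝ) (1 / 4)) {i : ι} {d : D} (hd : d ≠ b i) :
    Δ ≤ needleMean b i₀ v Δ i (b i) - needleMean b i₀ v Δ i d := by
  by_cases hi : b i = b i₀
  · rw [hi, needleMean_base_arm]
    by_cases hr : d ∈ Set.range b
    · obtain ⟨j, rfl⟩ := hr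
      rw [needleMean_of_ne hd, needleMean_base (hi ▸ hd)]
      linarith
    · rw [needleMean_of_notMem _ hr]
      linarith [(hv d).2, hΔ.2]
  · rw [needleMean_self hi, needleMean_of_ne hd]
    linarith [(needleMean_base_mem_Icc (b := b) (i₀ := i₀) hΔ hv d).2]

theorem abs_needleMean_sub_le (hΔ : 0 < Δ) (i : ι) :
    |needleMean b i₀ v Δ i (b i) - needleMean b i₀ v Δ i₀ (b i)| ≤ 2 * Δ := by
  by_cases hi : b i = b i₀
  · simp [hi, needleMean_base_arm, hΔ.le]
  · rw [needleMean_self hi, needleMean_base hi, abs_le]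
    constructor <;> linarith

end Needle

section NeedleRegret

variable {M C D ι : Type*} [MeasurableSpace M] [MeasurableSpace C] [MeasurableSpace D]
  [Fintype D] [Nonempty D] [LinearOrder D]
  [MeasurableSingletonClass D] [MeasurableSingletonClass M] [Countable C]
  [Nonempty C] [MeasurableSingletonClass C] [Fintype ι]
  {f : M → D → C → ℝ} {hf : Measurable fun x : M × (C × D) => f x.1 x.2.2 x.2.1}
  {h01 : ∀ m d c, f m d c ∈ Set.Icc (0 : ℝ) 1} {b : ι → D} {i₀ : ι} {v : D → ℝ}

theorem le_worstCaseRegret_of_needle_of_low_information (hinj : Function.Injective b)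
    (hv : ∀ d, v d ∈ Set.Icc (0 : ℝ) (1 / 4)) (hN : 2 ≤ Fintype.card ι)
    {mod : ι → M} (hμ : ∀ i d c, f (mod i) d c = needleMean b i₀ v (1 / 4) i d)
    (notion : InfoNotion) {R : ℝ} (hR : 0 ≤ R)
    (hRN : R * Real.log 2 ≤ Real.log (Fintype.card ι) / 8) (T : ℕ) :
    ((T / 32 : ℝ) : EReal) ≤ (bernoulliTask f hf h01).worstCaseRegret notion R T := by
  have : Nonempty ι := ⟨i₀⟩
  have hΔ : (1 / 4 : ℝ) ∈ Set.Ioc (0 : ℝ) (1 / 4) := by norm_num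
  set N := Fintype.card ι with hNdef
  have hN' : (2 : ℝ) ≤ N := by exact_mod_cast hN
  have hlogN : 0 < Real.log N := Real.log_pos (by linarith)
  have hgap : ∀ i d, (1 / 4 : ℝ) * (if d = b i then 0 else 1) ≤
      needleMean b i₀ v (1 / 4) i (b i) - needleMean b i₀ v (1 / 4) i d := by
    intro i d
    split_ifs with hd
    · simp [hd]
    · simpa using le_needleMean_sub hΔ hv hd
  -- With `s = log N`, the exponential moment of the loss is at most `(2 - 1 / N) / N`.
  have hsum : ∀ p : ι → Prop, (∀ i j, p i → p j → i = j) → ∀ _ : DecidablePred p,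
      (N : ℝ)⁻¹ * ∑ i, Real.exp (-Real.log N * if p i then 0 else 1) ≤
        Real.exp (-(Real.log N / 4)) := by
    intro p hp _
    have hexp : ∀ i, Real.exp (-Real.log N * if p i then 0 else 1) =
        (N : ℝ)⁻¹ + (1 - (N : ℝ)⁻¹) * if p i then 1 else 0 := by
      intro i
      split_ifs
      · simp
      · simp [Real.exp_neg, Real.exp_log (by linarith : (0 : ℝ) < N)]
    have hcount : ∑ i, (if p i then (1 : ℝ) else 0) ≤ 1 := by
      rw [Finset.sum_boole]
      exact_mod_cast Finset.card_le_one.2 fun i hi j hj =>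
        hp i j (Finset.mem_filter.1 hi).2 (Finset.mem_filter.1 hj).2
    have hinv : (N : ℝ)⁻¹ ≤ 1 := inv_le_one_of_one_le₀ (by linarith)
    simp only [hexp, Finset.sum_add_distrib, ← Finset.mul_sum, Finset.sum_const,
      Finset.card_univ, nsmul_eq_mul]
    rw [← hNdef, mul_inv_cancel₀ (by linarith)]
    calc (N : ℝ)⁻¹ * (1 + (1 - (N : ℝ)⁻¹) * ∑ i, if p i then (1 : ℝ) else 0)
        ≤ (N : ℝ)⁻¹ * (1 + (1 - (N : ℝ)⁻¹) * 1) := by gcongr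
      _ = Real.exp (-Real.log N) * Real.exp (Real.log (2 - (N : ℝ)⁻¹)) := by
          rw [Real.exp_neg, Real.exp_log (by linarith), Real.exp_log (by linarith)]
          ring
      _ ≤ Real.exp (-(Real.log N / 4)) := by
          rw [← Real.exp_add, Real.exp_le_exp]
          linarith [log_two_sub_inv_le hN]
  have key := le_worstCaseRegret_of_low_information (hf := hf) (h01 := h01) hμ
    (fun i d hd => by linarith [le_needleMean_sub (b := b) (i₀ := i₀) hΔ hv hd]) hinj
    (d₀ := b i₀) (fun i j => by rw [needleMean_base_arm, needleMean_base_arm])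
    (ρ := fun i d => if d = b i then 0 else 1) (s := Real.log N) (κ := Real.log N / 4)
    (γ := 1 / 4) hlogN (by norm_num) hgap
    (fun d => hsum (fun i => d = b i) (fun i j hi hj => hinj (hi.symm.trans hj)) _)
    (fun i => hsum (fun j => b j = b i) (fun j k hj hk => hinj (hj.trans hk.symm)) _)
    notion hR T
  refine le_trans (EReal.coe_le_coe_iff.2 ?_) key
  have : 1 / 8 ≤ (Real.log N / 4 - R * Real.log 2) / Real.log N := by
    rw [le_div_iff₀ hlogN]
    linarith
  rw [div_eq_mul_inv]
  refine mul_le_mul_of_nonneg_left ?_ (Nat.cast_nonneg T)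
  linarith

/-- The gap `Δ` is the largest one, up to a constant, for which `T` rounds do not suffice to find
the good arm: `Δ² T` is of the order of the number of arms. -/
theorem le_worstCaseRegret_of_needle (hinj : Function.Injective b)
    (hv : ∀ d, v d ∈ Set.Icc (0 : ℝ) (1 / 4)) (hN : 2 ≤ Fintype.card ι)
    (hμ : ∀ Δ ∈ Set.Ioc (0 : ℝ) (1 / 4), ∃ mod : ι → M,
      ∀ i d c, f (mod i) d c = needleMean b i₀ v Δ i d)
    (notion : InfoNotion) (R : ℝ) (T : ℕ) :
    ((min (T / 40 : ℝ) (Real.sqrt (T * Fintype.card ι) / 320) : ℝ) : EReal) ≤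
      (bernoulliTask f hf h01).worstCaseRegret notion R T := by
  have : Nonempty ι := ⟨i₀⟩
  set N : ℝ := ((Fintype.card ι : ℕ) : ℝ) with hNdef
  have hN' : 2 ≤ N := by rw [hNdef]; exact_mod_cast hN
  -- For `T = 0` any positive gap will do.
  set τ : ℝ := max T 1 with hτ
  have hτ1 : 1 ≤ τ := le_max_right _ _
  have hTτ : (T : ℝ) ≤ τ := le_max_left _ _
  set Δ : ℝ := min (1 / 4) (Real.sqrt (N / τ) / 32) with hΔdef
  have hΔ : Δ ∈ Set.Ioc (0 : ℝ) (1 / 4) :=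
    ⟨lt_min (by norm_num) (by positivity), min_le_left _ _⟩
  have hΔsq : Δ ^ 2 ≤ N / τ / 1024 := by
    calc Δ ^ 2 ≤ (Real.sqrt (N / τ) / 32) ^ 2 := pow_le_pow_left₀ hΔ.1.le (min_le_right _ _) 2
      _ = N / τ / 1024 := by
        rw [div_pow, Real.sq_sqrt (by positivity)]
        norm_num
  have hT : 22 * Δ ^ 2 * T ≤ N / 40 := by
    have h1 : Δ ^ 2 * T ≤ N / τ / 1024 * τ := mul_le_mul hΔsq hTτ (by positivity) (by positivity)
    have h2 : N / τ / 1024 * τ = N / 1024 := by field_simp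
    linarith
  obtain ⟨mod, hmod⟩ := hμ Δ hΔ
  have key := le_worstCaseRegret_of_smallGaps (hf := hf) (h01 := h01) hmod hinj
    (d₀ := b i₀) (fun i j => by rw [needleMean_base_arm, needleMean_base_arm])
    (β := needleMean b i₀ v Δ i₀) (fun d => needleMean_mem_Icc hΔ hv i₀ d)
    (fun i d hd => needleMean_of_ne hd)
    (fun i => ⟨by linarith [(needleMean_self_mem (b := b) (i₀ := i₀) (v := v) hΔ i).1],
      (needleMean_self_mem hΔ i).2⟩)
    (fun i => ⟨(needleMean_base_mem hΔ i).1,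
      by linarith [(needleMean_base_mem (b := b) (i₀ := i₀) (v := v) hΔ i).2]⟩)
    hΔ.1 (fun i => abs_needleMean_sub_le hΔ.1 i) (fun i d hd => le_needleMean_sub hΔ hv hd)
    hN hT notion R
  refine le_trans (EReal.coe_le_coe_iff.2 ?_) key
  rcases Nat.eq_zero_or_pos T with h0 | h0
  · simp [h0]
  have hτT : τ = T := max_eq_left (by exact_mod_cast h0)
  have hT0 : (0 : ℝ) < T := by exact_mod_cast h0
  rw [hΔdef, hτT]
  rcases min_choice (1 / 4 : ℝ) (Real.sqrt (N / T) / 32) with h | h <;> rw [h]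
  · exact (min_le_left _ _).trans (by linarith)
  · refine (min_le_right _ _).trans ?_
    have : Real.sqrt (T * N) = T * Real.sqrt (N / T) := by
      rw [Real.sqrt_eq_iff_mul_self_eq (by positivity) (by positivity)]
      have : Real.sqrt (N / T) * Real.sqrt (N / T) = N / T := Real.mul_self_sqrt (by positivity)
      calc (T : ℝ) * N = T * T * (N / T) := by field_simp
        _ = T * Real.sqrt (N / T) * (T * Real.sqrt (N / T)) := by
          linear_combination -((T : ℝ) * T) * this
    rw [this]
    linarith

end NeedleRegret

/-! ### The multi-armed bandit -/

theorem exists_needle_bernoulliMAB {K : ℕ} [NeZero K] {C : Type*} [Fintype C] [MeasurableSpace C]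
    [MeasurableSingletonClass C] {Δ : ℝ} (hΔ : Δ ∈ Set.Ioc (0 : ℝ) (1 / 4)) :
    ∃ mod : Fin K → (Fin K → C → Set.Icc (0 : ℝ) 1),
      ∀ i d c, (mod i d c : ℝ) = needleMean id (0 : Fin K) (fun _ => 0) Δ i d :=
  ⟨fun i d _ => ⟨needleMean id (0 : Fin K) (fun _ => 0) Δ i d,
    needleMean_mem_Icc hΔ (fun _ => by norm_num) i d⟩, fun _ _ _ => rfl⟩

theorem bernoulliMAB_low_information {K : ℕ} [NeZero K] (hK : 2 ≤ K) (C : Type*) [Fintype C]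
    [Nonempty C] [MeasurableSpace C] [MeasurableSingletonClass C] (notion : InfoNotion) {R : ℝ}
    (hR : 0 ≤ R) (hRK : R * Real.log 2 ≤ Real.log K / 8) (T : ℕ) :
    ((T / 32 : ℝ) : EReal) ≤ (bernoulliMAB K C).worstCaseRegret notion R T := by
  obtain ⟨mod, hmod⟩ := exists_needle_bernoulliMAB (K := K) (C := C) (Δ := 1 / 4) (by norm_num)
  exact le_worstCaseRegret_of_needle_of_low_information Function.injective_id
    (fun _ => by norm_num) (by simpa using hK) hmod notion hR (by simpa using hRK) T

theorem bernoulliMAB_sqrt {K : ℕ} [NeZero K] (hK : 2 ≤ K) (C : Type*) [Fintype C]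
    [Nonempty C] [MeasurableSpace C] [MeasurableSingletonClass C] (notion : InfoNotion) (R : ℝ)
    (T : ℕ) :
    ((min (T / 40 : ℝ) (Real.sqrt (T * K) / 320) : ℝ) : EReal) ≤
      (bernoulliMAB K C).worstCaseRegret notion R T := by
  have := le_worstCaseRegret_of_needle (b := (id : Fin K → Fin K)) (i₀ := 0) (v := fun _ => 0)
    (h01 := fun (m : Fin K → C → Set.Icc (0 : ℝ) 1) d c => (m d c).2)
    (hf := measurable_from_prod_countable_left fun x =>
      measurable_subtype_coe.comp
        ((measurable_pi_apply x.1).comp (measurable_pi_apply x.2)))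
    Function.injective_id (fun _ => by norm_num) (by simpa using hK)
    (fun Δ hΔ => exists_needle_bernoulliMAB hΔ) notion R T
  rwa [Fintype.card_fin] at this

/-! ### Linear bandits with orthonormal decisions -/

/-- Finitely many distinct points `y i`, followed by points of a sequence `z`, as `K` distinct
points. -/
theorem exists_extend_points {E ι : Type*} [Fintype ι] {K : ℕ} (hK : Fintype.card ι ≤ K)
    {y : ι → E} (hy : Function.Injective y) {z : ℕ → E} (hz : Function.Injective z)
    (hyz : ∀ i n, y i ≠ z n) :
    ∃ (x : Fin K → E) (b : ι → Fin K), Function.Injective x ∧ Function.Injective b ∧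
      (∀ i, x (b i) = y i) ∧ (∀ k, k ∉ Set.range b → ∃ n, x k = z n) ∧
      ∀ n, Fintype.card ι + n < K → ∃ k, k ∉ Set.range b ∧ x k = z n := by
  let e := Fintype.equivFin ι
  let x : Fin K → E := fun k =>
    if h : k.1 < Fintype.card ι then y (e.symm ⟨k.1, h⟩) else z (k.1 - Fintype.card ι)
  let b : ι → Fin K := fun i => ⟨(e i).1, (e i).2.trans_le hK⟩
  have hx1 : ∀ k : Fin K, ∀ h : k.1 < Fintype.card ι, x k = y (e.symm ⟨k.1, h⟩) :=
    fun k h => dif_pos h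
  have hx2 : ∀ k : Fin K, ¬ k.1 < Fintype.card ι → x k = z (k.1 - Fintype.card ι) :=
    fun k h => dif_neg h
  have hb : ∀ k : Fin K, k ∉ Set.range b ↔ ¬ k.1 < Fintype.card ι := by
    intro k
    refine not_congr ⟨?_, fun h => ⟨e.symm ⟨k.1, h⟩, ?_⟩⟩
    · rintro ⟨i, rfl⟩
      exact (e i).2
    · simp [b]
  refine ⟨x, b, ?_, ?_, fun i => ?_, fun k hk => ⟨_, hx2 k ((hb k).1 hk)⟩, fun n hn => ?_⟩
  · intro k l hkl
    by_cases hk : k.1 < Fintype.card ι <;> by_cases hl : l.1 < Fintype.card ι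
    · rw [hx1 k hk, hx1 l hl] at hkl
      simpa [Fin.ext_iff] using e.symm.injective (hy hkl)
    · rw [hx1 k hk, hx2 l hl] at hkl
      exact absurd hkl (hyz _ _)
    · rw [hx2 k hk, hx1 l hl] at hkl
      exact absurd hkl.symm (hyz _ _)
    · rw [hx2 k hk, hx2 l hl] at hkl
      have := hz hkl
      exact Fin.ext (by omega)
  · intro i j hij
    exact e.injective (Fin.ext (congrArg Fin.val hij :))
  · rw [hx1 (b i) (e i).2]
    simp [b]
  · refine ⟨⟨Fintype.card ι + n, hn⟩, (hb _).2 (by simp), ?_⟩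
    rw [hx2 _ (by simp)]
    simp

theorem span_eq_top_of_smul_single_mem {d : ℕ} {S : Set (EuclideanSpace ℝ (Fin d))}
    (h : ∀ l, ∃ a : ℝ, a ≠ 0 ∧ a • EuclideanSpace.single l (1 : ℝ) ∈ S) :
    Submodule.span ℝ S = ⊤ := by
  rw [eq_top_iff, ← (EuclideanSpace.basisFun (Fin d) ℝ).toBasis.span_eq, Submodule.span_le]
  rintro _ ⟨l, rfl⟩
  obtain ⟨a, ha, hl⟩ := h l
  have := Submodule.smul_mem _ a⁻¹ (Submodule.subset_span (R := ℝ) hl)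
  rw [smul_smul, inv_mul_cancel₀ ha, one_smul] at this
  simpa using this

/-- The decisions are the standard basis and, for the rest, multiples of its first vector with
a mean reward that does not depend on the model. -/
theorem exists_orthonormal_decisions {d K : ℕ} [NeZero K] (hd : 2 ≤ d) (hK : d ≤ K) :
    ∃ x : Fin K → EuclideanSpace ℝ (Fin d),
      Function.Injective x ∧ (∀ k, ‖x k‖ ≤ 1) ∧ Submodule.span ℝ (Set.range x) = ⊤ ∧
      ∀ (C : Type) [Fintype C] [Nonempty C] [MeasurableSpace C] [MeasurableSingletonClass C]
        (notion : InfoNotion) (T : ℕ),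
        (∀ R : ℝ, 0 ≤ R → R * Real.log 2 ≤ Real.log d / 8 →
          ((T / 32 : ℝ) : EReal) ≤ (linearBandit x C).worstCaseRegret notion R T) ∧
        ∀ R : ℝ, ((min (T / 40 : ℝ) (Real.sqrt (T * d) / 320) : ℝ) : EReal) ≤
          (linearBandit x C).worstCaseRegret notion R T := by
  have : NeZero d := ⟨by omega⟩
  let u : Fin d → EuclideanSpace ℝ (Fin d) := fun l => EuclideanSpace.single l (1 : ℝ)
  let z : ℕ → EuclideanSpace ℝ (Fin d) := fun n => ((n : ℝ) + 2)⁻¹ • u 0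
  have hτ : ∀ n : ℕ, ((n : ℝ) + 2)⁻¹ ∈ Set.Ioc (0 : ℝ) (1 / 2) := fun n => by
    refine ⟨by positivity, ?_⟩
    rw [one_div]
    exact inv_anti₀ two_pos (by linarith [(Nat.cast_nonneg n : (0 : ℝ) ≤ n)])
  have hu0 : ∀ n l, z n l = if l = 0 then ((n : ℝ) + 2)⁻¹ else 0 := fun n l => by
    simp [z, u]
  have hz : Function.Injective z := fun n m hnm => by
    have := congrArg (fun w : EuclideanSpace ℝ (Fin d) => w 0) hnm
    simpa [hu0] using this
  have hyz : ∀ i n, u i ≠ z n := fun i n hin => by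
    have := congrArg (fun w : EuclideanSpace ℝ (Fin d) => w i) hin
    have h := hτ n
    simp only [hu0] at this
    simp only [u, PiLp.single_apply, if_true] at this
    split_ifs at this
    · linarith [h.2]
    · norm_num at this
  have hu : Function.Injective u := fun i j hij => by
    have := congrArg (fun w : EuclideanSpace ℝ (Fin d) => w i) hij
    by_contra hne
    simp [u, hne] at this
  obtain ⟨x, b, hx, hb, hxb, hxz, -⟩ := exists_extend_points (K := K) (by simpa using hK) hu hz hyz
  -- The mean reward of the decision `x k` outside of the basis, if the first coordinate of the
  -- model is `1/2`.
  let v : Fin K → ℝ := fun k => if k ∈ Set.range b then 0 else x k 0 / 2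
  have hv : ∀ k, v k ∈ Set.Icc (0 : ℝ) (1 / 4) := by
    intro k
    by_cases hk : k ∈ Set.range b
    · simp only [v, if_pos hk]
      norm_num
    · obtain ⟨n, hn⟩ := hxz k hk
      have := hτ n
      simp only [v, if_neg hk, hn, hu0, if_true]
      exact ⟨by linarith [this.1], by linarith [this.2]⟩
  let θ : ℝ → Fin d → EuclideanSpace ℝ (Fin d) := fun Δ i =>
    WithLp.toLp 2 fun l => needleMean b 0 v Δ i (b l)
  have hθ : ∀ Δ i k, inner ℝ (θ Δ i) (x k) = needleMean b 0 v Δ i k := by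
    intro Δ i k
    by_cases hk : k ∈ Set.range b
    · obtain ⟨l, rfl⟩ := hk
      rw [hxb]
      simp [u, θ, EuclideanSpace.inner_single_right]
    · obtain ⟨n, hn⟩ := hxz k hk
      rw [needleMean_of_notMem _ hk]
      simp only [v, if_neg hk, hn, hu0, if_true]
      simp only [z, u, inner_smul_right, EuclideanSpace.inner_single_right, θ,
        needleMean_base_arm]
      simp
      ring
  have hmod : ∀ (C : Type) (Δ : ℝ), Δ ∈ Set.Ioc (0 : ℝ) (1 / 4) →
      ∃ mod : Fin d → LinearModel x C,
        ∀ i k c, inner ℝ ((mod i).1 c) (x k) = needleMean b 0 v Δ i k := fun C Δ hΔ =>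
    ⟨fun i => ⟨fun _ => θ Δ i, fun k _ => by rw [hθ]; exact needleMean_mem_Icc hΔ hv i k⟩,
      fun i k _ => hθ Δ i k⟩
  refine ⟨x, hx, fun k => ?_, ?_, ?_⟩
  · by_cases hk : k ∈ Set.range b
    · obtain ⟨l, rfl⟩ := hk
      simp [hxb, u]
    · obtain ⟨n, hn⟩ := hxz k hk
      have := hτ n
      rw [hn, norm_smul, Real.norm_of_nonneg this.1.le]
      simp only [u, PiLp.norm_single, norm_one, mul_one]
      linarith [this.2]
  · refine span_eq_top_of_smul_single_mem fun l => ⟨1, one_ne_zero, b l, ?_⟩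
    rw [hxb, one_smul]
  · intro C _ _ _ _ notion T
    refine ⟨fun R hR hRd => ?_, fun R => ?_⟩
    · obtain ⟨mod, h⟩ := hmod C (1 / 4) (by norm_num)
      exact le_worstCaseRegret_of_needle_of_low_information hb hv (by simpa using hd) h notion hR
        (by simpa using hRd) T
    · have := le_worstCaseRegret_of_needle (f := fun (m : LinearModel x C) k c =>
        inner ℝ (m.1 c) (x k)) (hf := measurable_from_prod_countable_left fun y => by
          have h : Measurable fun θ : LinearModel x C => θ.1 y.1 :=
            (measurable_pi_apply y.1).comp measurable_subtype_coe
          exact h.inner (measurable_const (a := x y.2))) (h01 := fun m k c => m.2 k c)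
        hb hv (by simpa using hd) (fun Δ hΔ => hmod C Δ hΔ) notion R T
      rwa [Fintype.card_fin] at this

/-! ### Linear bandits with decisions on a grid of a product of circles -/

theorem cos_sub_div_mem {s : ℕ} (a b : Fin s) :
    Real.cos ((a : ℝ) / s - (b : ℝ) / s) ∈ Set.Icc (0 : ℝ) 1 ∧
      (a ≠ b → 1 / (4 * (s : ℝ) ^ 2) ≤ 1 - Real.cos ((a : ℝ) / s - (b : ℝ) / s)) := by
  have hs : (0 : ℝ) < s := by exact_mod_cast a.pos
  set x : ℝ := (a : ℝ) / s - (b : ℝ) / s with hx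
  have ha : (a : ℝ) < s := by exact_mod_cast a.2
  have hb : (b : ℝ) < s := by exact_mod_cast b.2
  have ha0 : (0 : ℝ) ≤ a := Nat.cast_nonneg _
  have hb0 : (0 : ℝ) ≤ b := Nat.cast_nonneg _
  have hxs : x * s = a - b := by rw [hx]; field_simp
  have hx1 : |x| ≤ 1 := by
    rw [abs_le]
    constructor <;> nlinarith
  have hpi := Real.pi_gt_three
  refine ⟨⟨Real.cos_nonneg_of_neg_pi_div_two_le_of_le (by linarith [abs_le.1 hx1])
    (by linarith [abs_le.1 hx1]), Real.cos_le_one x⟩, fun hab => ?_⟩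
  have h1 : 1 ≤ (x * s) ^ 2 := by
    rw [hxs]
    have h2 : (1 : ℤ) ≤ ((a : ℤ) - (b : ℤ)) ^ 2 := by
      have : (a : ℤ) - (b : ℤ) ≠ 0 := fun h => hab (Fin.ext (by omega))
      have := sq_pos_of_ne_zero this
      omega
    exact_mod_cast h2
  have h2 := (abs_le.1 (Real.cos_bound hx1)).2
  have h3 : |x| ^ 4 = x ^ 2 * x ^ 2 := by
    rw [← pow_add, ← Even.pow_abs (by decide : Even 4) x]
  have h4 : x ^ 2 ≤ 1 := by
    rw [← sq_abs]
    exact pow_le_one₀ (abs_nonneg x) hx1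
  have h5 : x ^ 2 * x ^ 2 ≤ x ^ 2 := mul_le_of_le_one_left (sq_nonneg x) h4
  rw [h3] at h2
  have h6 : x ^ 2 / 4 ≤ 1 - Real.cos x := by nlinarith [sq_nonneg x]
  refine le_trans ?_ h6
  rw [mul_pow] at h1
  rw [div_le_div_iff₀ (by positivity) (by norm_num)]
  linarith

/-- A random point of the grid `{1, …, s}^n` is far from any given point in the Hamming
distance, in the sense of exponential moments. -/
theorem inv_mul_sum_exp_hammingDist_le {n s : ℕ} (hs : 2 ≤ s) (hn : 0 < n)
    (j' : Fin n → Fin s) :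
    ((Fintype.card (Fin n → Fin s) : ℕ) : ℝ)⁻¹ *
        ∑ j : Fin n → Fin s, Real.exp (-(n * Real.log s) * (hammingDist j j' / n)) ≤
      Real.exp (-(n * Real.log s / 4)) := by
  have hs' : (2 : ℝ) ≤ s := by exact_mod_cast hs
  have hn' : (n : ℝ) ≠ 0 := by exact_mod_cast hn.ne'
  have hexp : ∀ j : Fin n → Fin s, Real.exp (-(n * Real.log s) * (hammingDist j j' / n)) =
      ∏ p, if j p ≠ j' p then (s : ℝ)⁻¹ else 1 := by
    intro j
    rw [Finset.prod_ite, Finset.prod_const, Finset.prod_const_one, mul_one,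
      show -(n * Real.log s) * (hammingDist j j' / n) =
        (hammingDist j j' : ℝ) * -Real.log s by field_simp, Real.exp_nat_mul, Real.exp_neg,
      Real.exp_log (by linarith)]
    rfl
  have hprod : ∑ j : Fin n → Fin s, ∏ p, (if j p ≠ j' p then (s : ℝ)⁻¹ else 1) =
      (2 - (s : ℝ)⁻¹) ^ n := by
    rw [← Fintype.prod_sum fun p a => if a ≠ j' p then (s : ℝ)⁻¹ else 1]
    have : ∀ p, ∑ a, (if a ≠ j' p then (s : ℝ)⁻¹ else 1) = 2 - (s : ℝ)⁻¹ := by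
      intro p
      have h : ∀ a, (if a ≠ j' p then (s : ℝ)⁻¹ else 1) =
          (s : ℝ)⁻¹ + if a = j' p then 1 - (s : ℝ)⁻¹ else 0 := by
        intro a
        by_cases ha : a = j' p <;> simp [ha]
      simp only [h, Finset.sum_add_distrib, Finset.sum_const, Finset.card_univ, Fintype.card_fin,
        nsmul_eq_mul, Finset.sum_ite_eq', Finset.mem_univ, if_true]
      rw [mul_inv_cancel₀ (by linarith)]
      ring
    rw [Finset.prod_congr rfl fun p _ => this p]
    simp
  have hinv : (s : ℝ)⁻¹ ≤ 1 := inv_le_one_of_one_le₀ (by linarith)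
  simp only [hexp]
  rw [hprod]
  calc _ = Real.exp (-(n * Real.log s)) * Real.exp (n * Real.log (2 - (s : ℝ)⁻¹)) := by
        rw [Real.exp_neg, Real.exp_nat_mul, Real.exp_nat_mul, Real.exp_log (by linarith),
          Real.exp_log (by linarith)]
        simp
    _ ≤ _ := by
        rw [← Real.exp_add, Real.exp_le_exp]
        have := mul_le_mul_of_nonneg_left (log_two_sub_inv_le hs) (Nat.cast_nonneg (α := ℝ) n)
        linarith

/-- The size of the grid: `s` is the largest number with `s ^ n ≤ L`, where `n = d / 2`, or
`n = log₂ L` if this is smaller. In the first case, `s ^ 2 ≤ L ^ (2 / n)` and `n ≥ d / 4`; in the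
second, `s ≤ 3`. -/
theorem exists_grid_size {d L : ℕ} (hd : 2 ≤ d) (hL : 2 ≤ L) :
    ∃ n s : ℕ, 0 < n ∧ 2 * n ≤ d ∧ 2 ≤ s ∧ s ^ n ≤ L ∧ L ≤ (s ^ n) ^ 2 ∧
      (s : ℝ) ^ 2 ≤ 9 * (L : ℝ) ^ (8 / d : ℝ) := by
  set n := min (d / 2) (Nat.log 2 L) with hn
  have hlog : 0 < Nat.log 2 L := Nat.log_pos one_lt_two hL
  have hn0 : 0 < n := lt_min (by omega) hlog
  have h2n : 2 ^ n ≤ L := (Nat.pow_le_pow_right two_pos (min_le_right _ _)).trans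
    (Nat.pow_log_le_self 2 (by omega))
  set s := Nat.findGreatest (fun s => s ^ n ≤ L) L with hsdef
  have hsL : s ^ n ≤ L := Nat.findGreatest_spec (P := fun s => s ^ n ≤ L) hL h2n
  have hs2 : 2 ≤ s := Nat.le_findGreatest hL h2n
  have hs1 : L < (s + 1) ^ n := by
    by_contra! h
    have h1 : s + 1 ≤ L := (Nat.le_self_pow hn0.ne' _).trans h
    have := Nat.le_findGreatest (P := fun s => s ^ n ≤ L) h1 h
    omega
  have hL1 : (1 : ℝ) ≤ L := by exact_mod_cast (by omega : 1 ≤ L)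
  have hd' : (0 : ℝ) < d := by exact_mod_cast (by omega : 0 < d)
  refine ⟨n, s, hn0, by omega, hs2, hsL, ?_, ?_⟩
  · rw [← pow_mul, mul_comm, pow_mul]
    exact hs1.le.trans (Nat.pow_le_pow_left (by nlinarith) n)
  · have hpow1 : 1 ≤ (L : ℝ) ^ (8 / d : ℝ) := Real.one_le_rpow hL1 (by positivity)
    rcases le_total (d / 2) (Nat.log 2 L) with h | h
    · have hnd : n = d / 2 := min_eq_left h
      have hn4 : (d : ℝ) ≤ 4 * n := by exact_mod_cast (by omega : d ≤ 4 * n)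
      have hn' : (0 : ℝ) < n := by exact_mod_cast hn0
      have h1 : (s : ℝ) ^ 2 ≤ (L : ℝ) ^ (8 / d : ℝ) := by
        calc (s : ℝ) ^ 2 = (((s : ℝ) ^ n) ^ (2 / n : ℝ)) := by
              rw [← Real.rpow_natCast, ← Real.rpow_natCast, ← Real.rpow_mul (by positivity)]
              congr 1
              push_cast
              field_simp
          _ ≤ (L : ℝ) ^ (2 / n : ℝ) :=
              Real.rpow_le_rpow (by positivity) (by exact_mod_cast hsL) (by positivity)
          _ ≤ (L : ℝ) ^ (8 / d : ℝ) := by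
              refine Real.rpow_le_rpow_of_exponent_le hL1 ?_
              rw [div_le_div_iff₀ hn' hd']
              linarith
      linarith
    · have hnl : n = Nat.log 2 L := min_eq_right h
      have h1 : L < 2 ^ (n + 1) := hnl ▸ Nat.lt_pow_succ_log_self one_lt_two L
      have h2 : s < 4 := by
        by_contra! h4
        have : 4 ^ n ≤ L := (Nat.pow_le_pow_left h4 n).trans hsL
        have h5 : 2 ^ (n + 1) ≤ 4 ^ n := by
          rw [show 4 = 2 ^ 2 by norm_num, ← pow_mul]
          exact Nat.pow_le_pow_right two_pos (by omega)
        omega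
      have h3 : (s : ℝ) ≤ 3 := by exact_mod_cast (by omega : s ≤ 3)
      have : (s : ℝ) ^ 2 ≤ 3 ^ 2 := pow_le_pow_left₀ (by positivity) h3 2
      linarith

/-- Unit vectors indexed by a grid, with nonnegative coordinates, whose distances are controlled
by the Hamming distance: in each of `n` orthogonal planes, one of `s` equally spaced points on an
arc of a circle. -/
theorem exists_grid_vectors {d n s : ℕ} (hn : 0 < n) (hnd : 2 * n ≤ d) (hs : 0 < s) :
    ∃ y : (Fin n → Fin s) → EuclideanSpace ℝ (Fin d),
      (∀ j, ‖y j‖ = 1) ∧ (∀ j l, 0 ≤ y j l) ∧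
      (∀ j j', 0 ≤ inner ℝ (y j) (y j')) ∧
      ∀ j j', 1 / (4 * (s : ℝ) ^ 2) * (hammingDist j j' / n) ≤ 1 - inner ℝ (y j) (y j') := by
  have hn' : (0 : ℝ) < n := by exact_mod_cast hn
  let φ : Fin n ⊕ Fin n → Fin d := fun m => Fin.castLE (by omega) (finSumFinEquiv m)
  have hφ : Function.Injective φ :=
    (Fin.castLE_injective _).comp finSumFinEquiv.injective
  let u : Fin n ⊕ Fin n → EuclideanSpace ℝ (Fin d) := fun m => EuclideanSpace.single (φ m) (1 : ℝ)
  have hu : Orthonormal ℝ u := (EuclideanSpace.orthonormal_single (𝕜 := ℝ)).comp φ hφ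
  let a : (Fin n → Fin s) → Fin n ⊕ Fin n → ℝ := fun j =>
    Sum.elim (fun p => Real.cos ((j p : ℝ) / s) / Real.sqrt n)
      fun p => Real.sin ((j p : ℝ) / s) / Real.sqrt n
  have hinner : ∀ j j', inner ℝ (∑ m, a j m • u m) (∑ m, a j' m • u m) =
      (∑ p, Real.cos ((j p : ℝ) / s - (j' p : ℝ) / s)) / n := by
    intro j j'
    rw [hu.inner_sum, Fintype.sum_sum_type, ← Finset.sum_add_distrib, Finset.sum_div]
    refine Finset.sum_congr rfl fun p _ => ?_
    have hsq : Real.sqrt n * Real.sqrt n = n := Real.mul_self_sqrt hn'.le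
    simp only [a, Sum.elim_inl, Sum.elim_inr, conj_trivial]
    rw [Real.cos_sub, div_mul_div_comm, div_mul_div_comm, hsq, add_div]
  have hgap : ∀ j j', 1 / (4 * (s : ℝ) ^ 2) * (hammingDist j j' / n) ≤
      1 - inner ℝ (∑ m, a j m • u m) (∑ m, a j' m • u m) := by
    intro j j'
    have h1 : (hammingDist j j' : ℝ) = ∑ p, if j p ≠ j' p then (1 : ℝ) else 0 := by
      rw [Finset.sum_boole]
      rfl
    have h2 : 1 - inner ℝ (∑ m, a j m • u m) (∑ m, a j' m • u m) =
        (∑ p, (1 - Real.cos ((j p : ℝ) / s - (j' p : ℝ) / s))) / n := by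
      rw [hinner, Finset.sum_sub_distrib]
      simp only [Finset.sum_const, Finset.card_univ, Fintype.card_fin, nsmul_eq_mul, mul_one]
      field_simp
    rw [h2, ← mul_div_assoc, h1, Finset.mul_sum]
    refine div_le_div_of_nonneg_right (Finset.sum_le_sum fun p _ => ?_) hn'.le
    obtain ⟨h3, h4⟩ := cos_sub_div_mem (j p) (j' p)
    split_ifs with hp
    · rw [mul_one]
      exact h4 hp
    · rw [mul_zero]
      linarith [h3.2]
  refine ⟨fun j => ∑ m, a j m • u m, fun j => ?_, fun j l => ?_, fun j j' => ?_, hgap⟩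
  · have : ‖∑ m, a j m • u m‖ ^ 2 = 1 := by
      rw [← real_inner_self_eq_norm_sq, hinner]
      simp [hn'.ne']
    exact (pow_eq_one_iff_of_nonneg (norm_nonneg _) two_ne_zero).1 this
  · have hang : ∀ p, (j p : ℝ) / s ∈ Set.Icc (0 : ℝ) 1 := fun p =>
      ⟨by positivity, div_le_one_of_le₀ (by exact_mod_cast (j p).2.le) (Nat.cast_nonneg s)⟩
    have hpi := Real.pi_gt_three
    have ha : ∀ m, 0 ≤ a j m := by
      rintro (p | p)
      · exact div_nonneg (Real.cos_nonneg_of_neg_pi_div_two_le_of_le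
          (by linarith [(hang p).1]) (by linarith [(hang p).2])) (Real.sqrt_nonneg _)
      · exact div_nonneg (Real.sin_nonneg_of_nonneg_of_le_pi (hang p).1
          (by linarith [(hang p).2])) (Real.sqrt_nonneg _)
    simp only [WithLp.ofLp_sum, WithLp.ofLp_smul, Finset.sum_apply, Pi.smul_apply, smul_eq_mul]
    refine Finset.sum_nonneg fun m _ => mul_nonneg (ha m) ?_
    simp only [u, PiLp.single_apply]
    split_ifs <;> norm_num
  · rw [hinner]
    exact div_nonneg (Finset.sum_nonneg fun p _ => (cos_sub_div_mem (j p) (j' p)).1.1) hn'.le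

/-- The decisions are a grid of unit vectors and, for the rest, the zero vector, which makes an
uninformed agent possible, and short multiples of the standard basis, which span the space. -/
theorem exists_grid_decisions {d K : ℕ} [NeZero K] (hd : 2 ≤ d) (hK : 2 * d + 2 ≤ K) :
    ∃ x : Fin K → EuclideanSpace ℝ (Fin d),
      Function.Injective x ∧ (∀ k, ‖x k‖ ≤ 1) ∧ Submodule.span ℝ (Set.range x) = ⊤ ∧
      ∀ (C : Type) [Fintype C] [Nonempty C] [MeasurableSpace C] [MeasurableSingletonClass C]
        (notion : InfoNotion) (T : ℕ),
        ∀ R : ℝ, 0 ≤ R → R * Real.log 2 ≤ Real.log K / 32 →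
          ((T * (K : ℝ) ^ (-8 / d : ℝ) / 288 : ℝ) : EReal) ≤
            (linearBandit x C).worstCaseRegret notion R T := by
  have hd0 : 0 < d := by omega
  obtain ⟨n, s, hn, hnd, hs, hsL, hLs, hs9⟩ := exists_grid_size (L := K - d - 1) hd (by omega)
  obtain ⟨y, hy1, hy0, hyy, hgap⟩ := exists_grid_vectors hn hnd (by omega : 0 < s)
  have hs' : (2 : ℝ) ≤ s := by exact_mod_cast hs
  have hn' : (0 : ℝ) < n := by exact_mod_cast hn
  have hlogs : 0 < Real.log s := Real.log_pos (by linarith)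
  set γ : ℝ := 1 / (4 * (s : ℝ) ^ 2) with hγ
  have hγ0 : 0 < γ := by positivity
  have hγ1 : γ ≤ 3 / 4 := by
    rw [hγ, div_le_iff₀ (by positivity)]
    nlinarith
  have hyinj : Function.Injective y := by
    intro j j' hjj
    have h := hgap j j'
    rw [hjj, real_inner_self_eq_norm_sq, hy1] at h
    have h1 : (hammingDist j j' : ℝ) / n ≤ 0 := by
      by_contra! hc
      have := mul_pos hγ0 hc
      norm_num at h
      linarith
    have h2 : (hammingDist j j' : ℝ) ≤ 0 := by
      by_contra! hc
      exact (div_pos hc hn').not_ge h1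
    exact hammingDist_eq_zero.1 (by exact_mod_cast le_antisymm h2 (Nat.cast_nonneg _))
  -- The further decisions, in this order: the zero vector, and in turn the multiples of the basis
  -- vectors, of distinct lengths.
  let τ : ℕ → ℝ := fun m => if m = 0 then 0 else ((m : ℝ) + 3)⁻¹
  let z : ℕ → EuclideanSpace ℝ (Fin d) := fun m =>
    τ m • EuclideanSpace.single (⟨(m - 1) % d, Nat.mod_lt _ hd0⟩ : Fin d) (1 : ℝ)
  have hτ : ∀ m, τ m ∈ Set.Icc (0 : ℝ) (1 / 4) := by
    intro m
    by_cases hm : m = 0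
    · simp [τ, hm]
    · have : (1 : ℝ) ≤ m := by exact_mod_cast Nat.one_le_iff_ne_zero.2 hm
      simp only [τ, if_neg hm]
      refine ⟨by positivity, ?_⟩
      rw [one_div]
      exact inv_anti₀ (by norm_num) (by linarith)
  have hznorm : ∀ m, ‖z m‖ = τ m := fun m => by
    simp only [z, norm_smul, PiLp.norm_single, norm_one, mul_one]
    exact Real.norm_of_nonneg (hτ m).1
  have hτpos : ∀ m : ℕ, m ≠ 0 → τ m = ((m : ℝ) + 3)⁻¹ := fun m hm => if_neg hm
  have hz : Function.Injective z := by
    intro m m' h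
    have h1 : τ m = τ m' := by rw [← hznorm, ← hznorm, h]
    by_cases hm : m = 0 <;> by_cases hm' : m' = 0
    · rw [hm, hm']
    · rw [hτpos m' hm', hm] at h1
      have : (0 : ℝ) < ((m' : ℝ) + 3)⁻¹ := by positivity
      simp only [τ, if_true] at h1
      linarith
    · rw [hτpos m hm, hm'] at h1
      have : (0 : ℝ) < ((m : ℝ) + 3)⁻¹ := by positivity
      simp only [τ, if_true] at h1
      linarith
    · rw [hτpos m hm, hτpos m' hm', inv_inj] at h1
      exact_mod_cast (by linarith : (m : ℝ) = m')
  have hyz : ∀ j m, y j ≠ z m := fun j m h => by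
    have h1 := hznorm m
    rw [← h, hy1] at h1
    linarith [(hτ m).2]
  have hcard : Fintype.card (Fin n → Fin s) = s ^ n := by simp
  obtain ⟨x, b, hx, hb, hxb, hxz, hxz'⟩ := exists_extend_points (K := K) (by rw [hcard]; omega)
    hyinj hz hyz
  have hxnorm : ∀ k, ‖x k‖ ≤ 1 := by
    intro k
    by_cases hk : k ∈ Set.range b
    · obtain ⟨j, rfl⟩ := hk
      rw [hxb, hy1]
    · obtain ⟨m, hm⟩ := hxz k hk
      rw [hm, hznorm]
      linarith [(hτ m).2]
  have hyz_mem : ∀ j k, k ∉ Set.range b → inner ℝ (y j) (x k) ∈ Set.Icc (0 : ℝ) (1 / 4) := by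
    intro j k hk
    obtain ⟨m, hm⟩ := hxz k hk
    constructor
    · rw [hm, inner_smul_right, EuclideanSpace.inner_single_right]
      simpa using mul_nonneg (hτ m).1 (hy0 j _)
    · refine (real_inner_le_norm _ _).trans ?_
      rw [hy1, one_mul, hm, hznorm]
      exact (hτ m).2
  have hmem : ∀ j k, inner ℝ (y j) (x k) ∈ Set.Icc (0 : ℝ) 1 := by
    intro j k
    refine ⟨?_, (real_inner_le_norm _ _).trans (by rw [hy1, one_mul]; exact hxnorm k)⟩
    by_cases hk : k ∈ Set.range b
    · obtain ⟨j', rfl⟩ := hk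
      rw [hxb]
      exact hyy j j'
    · exact (hyz_mem j k hk).1
  refine ⟨x, hx, hxnorm, ?_, ?_⟩
  · refine span_eq_top_of_smul_single_mem fun l => ?_
    obtain ⟨k, -, hk⟩ := hxz' (l.1 + 1) (by rw [hcard]; omega)
    refine ⟨τ (l.1 + 1), ?_, k, ?_⟩
    · rw [hτpos _ (by omega)]
      positivity
    · rw [hk]
      simp [z, Nat.mod_eq_of_lt l.2]
  intro C _ _ _ _ notion T R hR hRK
  classical
  obtain ⟨k₀, -, hk₀⟩ := hxz' 0 (by rw [hcard]; omega)
  have hk₀0 : x k₀ = 0 := by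
    rw [hk₀]
    simp [z, τ]
  let mod : (Fin n → Fin s) → LinearModel x C := fun j => ⟨fun _ => y j, fun k _ => hmem j k⟩
  have : Nonempty (Fin n → Fin s) := ⟨fun _ => ⟨0, by omega⟩⟩
  -- The loss is the fraction of wrong coordinates, and that of a decision off the grid is one.
  let ρ : (Fin n → Fin s) → Fin K → ℝ := fun j k =>
    if k ∈ Set.range b then (hammingDist j (Function.invFun b k) : ℝ) / n else 1
  have hρb : ∀ j j', ρ j (b j') = (hammingDist j j' : ℝ) / n := fun j j' => by
    simp only [ρ, Set.mem_range_self, if_true, Function.leftInverse_invFun hb j']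
  have hgapρ : ∀ j k, γ * ρ j k ≤ inner ℝ (y j) (x (b j)) - inner ℝ (y j) (x k) := by
    intro j k
    rw [hxb, real_inner_self_eq_norm_sq, hy1, one_pow]
    by_cases hk : k ∈ Set.range b
    · obtain ⟨j', rfl⟩ := hk
      rw [hρb, hxb]
      exact hgap j j'
    · simp only [ρ, if_neg hk, mul_one]
      linarith [(hyz_mem j k hk).2]
  have hstrict : ∀ j k, k ≠ b j → inner ℝ (y j) (x k) < inner ℝ (y j) (x (b j)) := by
    intro j k hk
    have hρ0 : 0 < ρ j k := by
      by_cases hkr : k ∈ Set.range b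
      · obtain ⟨j', rfl⟩ := hkr
        rw [hρb]
        refine div_pos ?_ hn'
        exact_mod_cast hammingDist_pos.2 fun h => hk (by rw [h])
      · simp only [ρ, if_neg hkr]
        norm_num
    linarith [hgapρ j k, mul_pos hγ0 hρ0]
  have hnlog : 0 < n * Real.log s := mul_pos hn' hlogs
  have key := le_worstCaseRegret_of_low_information
    (f := fun (m : LinearModel x C) k c => inner ℝ (m.1 c) (x k))
    (hf := measurable_from_prod_countable_left fun y => by
      have h : Measurable fun θ : LinearModel x C => θ.1 y.1 :=
        (measurable_pi_apply y.1).comp measurable_subtype_coe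
      exact h.inner (measurable_const (a := x y.2))) (h01 := fun m k c => m.2 k c)
    (mod := mod) (μ := fun j k => inner ℝ (y j) (x k)) (fun _ _ _ => rfl) hstrict hb (d₀ := k₀)
    (fun i j => by simp [hk₀0]) (ρ := ρ) (s := n * Real.log s) (κ := n * Real.log s / 4) hnlog
    hγ0.le hgapρ
    (fun k => by
      by_cases hk : k ∈ Set.range b
      · obtain ⟨j', rfl⟩ := hk
        simp only [hρb]
        exact inv_mul_sum_exp_hammingDist_le hs hn j'
      · simp only [ρ, if_neg hk, mul_one, Finset.sum_const, Finset.card_univ, nsmul_eq_mul]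
        rw [inv_mul_cancel_left₀ (Nat.cast_ne_zero.2 Fintype.card_ne_zero), Real.exp_le_exp]
        linarith)
    (fun j => by
      simp only [hρb]
      simp only [fun j' => hammingDist_comm j j']
      exact inv_mul_sum_exp_hammingDist_le hs hn j)
    notion hR T
  refine le_trans (EReal.coe_le_coe_iff.2 ?_) key
  have hK0 : (0 : ℝ) < K := by exact_mod_cast (by omega : 0 < K)
  -- The grid is not much smaller than `Π`: it has `s ^ n ≥ √(K - d - 1)` points, and
  -- `K - d - 1 ≥ K / 2 ≥ √K`.
  have hlogK : Real.log K ≤ 4 * (n * Real.log s) := by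
    have h1 : K ≤ (s ^ n) ^ 4 := by
      have h2 : K ≤ (K - d - 1) ^ 2 := by
        obtain ⟨e, he⟩ : ∃ e, K - d - 1 = e := ⟨_, rfl⟩
        rw [he]
        have : K ≤ 2 * e := by omega
        nlinarith
      calc K ≤ (K - d - 1) ^ 2 := h2
        _ ≤ ((s ^ n) ^ 2) ^ 2 := Nat.pow_le_pow_left hLs 2
        _ = (s ^ n) ^ 4 := by ring
    have h3 : (K : ℝ) ≤ ((s : ℝ) ^ n) ^ 4 := by exact_mod_cast h1
    have h4 := Real.log_le_log hK0 h3
    rw [Real.log_pow, Real.log_pow] at h4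
    exact_mod_cast h4
  have hloss : 1 / 8 ≤ (n * Real.log s / 4 - R * Real.log 2) / (n * Real.log s) := by
    rw [le_div_iff₀ hnlog]
    linarith
  have hpow : (K : ℝ) ^ (-8 / d : ℝ) / 36 ≤ γ := by
    have h1 : (s : ℝ) ^ 2 ≤ 9 * (K : ℝ) ^ (8 / d : ℝ) := by
      refine hs9.trans (mul_le_mul_of_nonneg_left (Real.rpow_le_rpow (by positivity) ?_
        (by positivity)) (by norm_num))
      exact_mod_cast (by omega : K - d - 1 ≤ K)
    have h2 : 0 < (K : ℝ) ^ (8 / d : ℝ) := Real.rpow_pos_of_pos hK0 _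
    rw [neg_div, Real.rpow_neg hK0.le, hγ, inv_eq_one_div, div_div,
      div_le_div_iff₀ (by positivity) (by positivity)]
    linarith
  calc T * (K : ℝ) ^ (-8 / d : ℝ) / 288 = T * ((K : ℝ) ^ (-8 / d : ℝ) / 36 * (1 / 8)) := by ring
    _ ≤ _ := by
        refine mul_le_mul_of_nonneg_left ?_ (Nat.cast_nonneg T)
        exact mul_le_mul hpow hloss (by norm_num) hγ0.le

/-! ### Comparison of the rates -/

theorem mul_log_two_le {R c : ℝ} {K : ℕ} (h : R ≤ c * Real.logb 2 K) :
    R * Real.log 2 ≤ c * Real.log K := by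
  have h2 : 0 < Real.log 2 := Real.log_pos one_lt_two
  calc R * Real.log 2 ≤ c * Real.logb 2 K * Real.log 2 := mul_le_mul_of_nonneg_right h h2.le
    _ = c * Real.log K := by rw [Real.logb]; field_simp

/-- If `R` is of the order of `L = log K`, the factor `L / R` is bounded. -/
theorem min_sqrt_le {T n S L R : ℝ} (hT : 0 ≤ T) (hn : 0 ≤ n) (hS : S ≤ T) (hR : 0 < R)
    (hLR : L ≤ 32 * R) :
    1 / 2000 * min S (Real.sqrt (T * n * (L / R))) ≤ min (T / 40) (Real.sqrt (T * n) / 320) := by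
  have hTn : 0 ≤ T * n := mul_nonneg hT hn
  have h1 : Real.sqrt (T * n * (L / R)) ≤ 6 * Real.sqrt (T * n) := by
    have h36 : Real.sqrt 36 = 6 := by
      rw [show (36 : ℝ) = 6 ^ 2 by norm_num]
      exact Real.sqrt_sq (by norm_num)
    rw [← h36, ← Real.sqrt_mul (by norm_num), mul_comm]
    refine Real.sqrt_le_sqrt (mul_le_mul_of_nonneg_right ?_ hTn)
    rw [div_le_iff₀ hR]
    linarith
  have h2 := Real.sqrt_nonneg (T * n)
  refine le_min ?_ ?_
  · linarith [min_le_left S (Real.sqrt (T * n * (L / R)))]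
  · linarith [min_le_right S (Real.sqrt (T * n * (L / R)))]

theorem proposition2 :
    ∃ a : ℝ, 0 < a ∧
      -- decision spaces of size `K`
      (∀ K : ℕ, ∀ _ : NeZero K, 2 ≤ K →
        ∀ (C : Type) [Fintype C] [Nonempty C] [MeasurableSpace C] [MeasurableSingletonClass C]
          (notion : InfoNotion) (T : ℕ),
          (∀ R : ℝ, 0 < R → R ≤ Real.logb 2 K →
            ((a * min (T : ℝ) (Real.sqrt (T * K * (Real.logb 2 K / R))) : ℝ) : EReal) ≤
              (bernoulliMAB K C).worstCaseRegret notion R T) ∧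
          ((a * T : ℝ) : EReal) ≤ (bernoulliMAB K C).worstCaseRegret notion 0 T ∧
          (bernoulliMAB K C).worstCaseRegret notion 0 T ≤ ((T : ℝ) : EReal)) ∧
      -- linear rewards, decisions in the Euclidean unit ball
      (∀ d K : ℕ, ∀ _ : NeZero K, 2 ≤ d → d ≤ K →
        (∀ R : ℝ, 0 < R → R ≤ Real.logb 2 K →
          ∃ x : Fin K → EuclideanSpace ℝ (Fin d),
            Function.Injective x ∧ (∀ k, ‖x k‖ ≤ 1) ∧ Submodule.span ℝ (Set.range x) = ⊤ ∧
            ∀ (C : Type) [Fintype C] [Nonempty C] [MeasurableSpace C]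
              [MeasurableSingletonClass C] (notion : InfoNotion) (T : ℕ),
              ((a * min (T * (K : ℝ) ^ (-8 / d : ℝ))
                  (Real.sqrt (T * d * (Real.logb 2 K / R))) : ℝ) : EReal) ≤
                (linearBandit x C).worstCaseRegret notion R T) ∧
        ∃ x : Fin K → EuclideanSpace ℝ (Fin d),
          Function.Injective x ∧ (∀ k, ‖x k‖ ≤ 1) ∧ Submodule.span ℝ (Set.range x) = ⊤ ∧
          ∀ (C : Type) [Fintype C] [Nonempty C] [MeasurableSpace C]
            [MeasurableSingletonClass C] (notion : InfoNotion) (T : ℕ),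
            ((a * T : ℝ) : EReal) ≤ (linearBandit x C).worstCaseRegret notion 0 T ∧
            (linearBandit x C).worstCaseRegret notion 0 T ≤ ((T : ℝ) : EReal)) := by
  refine ⟨1 / 2000, by norm_num, ?_, ?_⟩
  · intro K _ hK C _ _ _ _ notion T
    have hlogK : 0 ≤ Real.log K := Real.log_natCast_nonneg K
    refine ⟨fun R hR hRK => ?_, ?_, DecisionTask.worstCaseRegret_le _ _ _ _⟩
    · rcases le_total R (1 / 32 * Real.logb 2 K) with h | h
      · refine le_trans (EReal.coe_le_coe_iff.2 ?_) (bernoulliMAB_low_information hK C notion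
          hR.le ((mul_log_two_le h).trans (by linarith)) T)
        have := min_le_left (T : ℝ) (Real.sqrt (T * K * (Real.logb 2 K / R)))
        have hT : (0 : ℝ) ≤ T := Nat.cast_nonneg T
        linarith
      · exact le_trans (EReal.coe_le_coe_iff.2 (min_sqrt_le (Nat.cast_nonneg T)
          (Nat.cast_nonneg K) le_rfl hR (by linarith))) (bernoulliMAB_sqrt hK C notion R T)
    · refine le_trans (EReal.coe_le_coe_iff.2 ?_) (bernoulliMAB_low_information hK C notion
        le_rfl (by rw [zero_mul]; positivity) T)
      have hT : (0 : ℝ) ≤ T := Nat.cast_nonneg T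
      linarith
  · intro d K _ hd hdK
    have hlogd : 0 ≤ Real.log d := Real.log_natCast_nonneg d
    have hK1 : (1 : ℝ) ≤ K := by exact_mod_cast (by omega : 1 ≤ K)
    refine ⟨fun R hR hRK => ?_, ?_⟩
    · have hpow0 : 0 < (K : ℝ) ^ (-8 / d : ℝ) := Real.rpow_pos_of_pos (by linarith) _
      have hpow1 : (K : ℝ) ^ (-8 / d : ℝ) ≤ 1 := Real.rpow_le_one_of_one_le_of_nonpos hK1
        (div_nonpos_of_nonpos_of_nonneg (by norm_num) (Nat.cast_nonneg d))
      have hTpow : ∀ T : ℕ, (T : ℝ) * (K : ℝ) ^ (-8 / d : ℝ) ≤ T := fun T =>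
        mul_le_of_le_one_right (Nat.cast_nonneg T) hpow1
      rcases le_total R (1 / 32 * Real.logb 2 K) with h | h
      · have hRlog := mul_log_two_le h
        by_cases hK2 : 2 * d + 2 ≤ K
        · obtain ⟨x, hx, hx1, hspan, hreg⟩ := exists_grid_decisions hd hK2
          refine ⟨x, hx, hx1, hspan, fun C _ _ _ _ notion T => ?_⟩
          refine le_trans (EReal.coe_le_coe_iff.2 ?_) (hreg C notion T R hR.le (by linarith))
          have h1 := min_le_left (T * (K : ℝ) ^ (-8 / d : ℝ))
            (Real.sqrt (T * d * (Real.logb 2 K / R)))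
          have h2 : 0 ≤ (T : ℝ) * (K : ℝ) ^ (-8 / d : ℝ) := by positivity
          linarith
        · -- Here `K ≤ 2 d + 1 ≤ d ^ 3`, so that the orthonormal decisions are numerous enough.
          have hKd : Real.log K ≤ 3 * Real.log d := by
            have h1 : K ≤ d ^ 3 := by nlinarith [Nat.mul_le_mul hd hd]
            have h2 := Real.log_le_log (by linarith) ((Nat.cast_le (α := ℝ)).2 h1)
            rw [Nat.cast_pow, Real.log_pow] at h2
            exact_mod_cast h2
          obtain ⟨x, hx, hx1, hspan, hreg⟩ := exists_orthonormal_decisions hd hdK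
          refine ⟨x, hx, hx1, hspan, fun C _ _ _ _ notion T => ?_⟩
          refine le_trans (EReal.coe_le_coe_iff.2 ?_)
            ((hreg C notion T).1 R hR.le (by linarith))
          have h1 := min_le_left (T * (K : ℝ) ^ (-8 / d : ℝ))
            (Real.sqrt (T * d * (Real.logb 2 K / R)))
          have hT : (0 : ℝ) ≤ T := Nat.cast_nonneg T
          linarith [hTpow T]
      · obtain ⟨x, hx, hx1, hspan, hreg⟩ := exists_orthonormal_decisions hd hdK
        refine ⟨x, hx, hx1, hspan, fun C _ _ _ _ notion T => ?_⟩
        exact le_trans (EReal.coe_le_coe_iff.2 (min_sqrt_le (Nat.cast_nonneg T)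
          (Nat.cast_nonneg d) (hTpow T) hR (by linarith))) ((hreg C notion T).2 R)
    · obtain ⟨x, hx, hx1, hspan, hreg⟩ := exists_orthonormal_decisions hd hdK
      refine ⟨x, hx, hx1, hspan, fun C _ _ _ _ notion T =>
        ⟨?_, DecisionTask.worstCaseRegret_le _ _ _ _⟩⟩
      refine le_trans (EReal.coe_le_coe_iff.2 ?_)
        ((hreg C notion T).1 0 le_rfl (by rw [zero_mul]; positivity))
      have hT : (0 : ℝ) ≤ T := Nat.cast_nonneg T
      linarith
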